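/- Let $d\ge 1$, and let $\kappa_d$ be the volume of the unit ball of $\mathbb{R}^d$. Let $f=\{f(t)\}_{t\in\mathbb{R}^d}$ be a measurable process with values in $[0,\infty]$ and $\mathbb{E}\int_{\mathbb{R}^d}f(t)\,dt=1$, with law $\mathbb{P}_f$ (a *random shape*). A *mixed moving maxima (M3) process* with random shape $f$ is a process $X$ on $\mathbb{R}^d$ with the same finite-dimensional distributions as $\{\sup_n U_n f_n(t-z_n)\}_{t\in\mathbb{R}^d}$, where $(U_n,z_n,f_n)_n$ are the points of a Poisson point process with intensity $u^{-2}du\times dz\times\mathbb{P}_f(df)$ on $(0,\infty)\times\mathbb{R}^d\times\mathbb{F}$, $\mathbb{F}$ being the space of shapes. Its *tail correlation function* (TCF) is $\chi(t)=\lim_{\tau\to\infty}\mathbb{P}(X_t\ge\tau\mid X_o\ge\tau)$, $t\in\mathbb{R}^d$. Denote by * $T^d_{\mathrm{M3r}}$ the set of TCFs of M3 processes such that every realization of the random shape is a radial function that is non-increasing in the radius; * $T^d_{\mathrm{M2r}}$ the set of TCFs of such processes with a deterministic shape $f$, that is, $f(x)=f(\|x\|)$ with $f:[0,\infty)\to[0,\infty]$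 non-increasing and $\int_{\mathbb{R}^d}f(\|x\|)\,dx=1$; * $T^d_{\mathrm{M3b}}$ the set of TCFs of M3 processes whose random shape is $\mathbf{1}_{\{\|x\|\le R\}}/(\kappa_dR^d)$ with a random radius $R\in(0,\infty)$; * $H_d$ the set of functions $\chi(x)=\varphi(\|x\|)$ on $\mathbb{R}^d$ with $\varphi(t)=\int_{(0,\infty)}h_d(st)\,dG(s)$, where $G$ is a probability distribution on $(0,\infty)$ and $$h_d(t)=\frac{d\,\Gamma(d/2)}{\sqrt{\pi}\,\Gamma((d+1)/2)}\int_t^1(1-v^2)^{(d-1)/2}\,dv\quad(0\le t\le 1),\qquad h_d(t)=0\quad(t>1).$$ a) $T^d_{\mathrm{M3r}}=T^d_{\mathrm{M2r}}=T^d_{\mathrm{M3b}}=H_d$. b) Let $f$ be a deterministic shape as in the definition of $T^d_{\mathrm{M2r}}$, let $R\in(0,\infty)$ be a random radius, and let $H$ be the distribution function of $1/R$. Then the following are equivalent: (i) the M2r process with shape $f$ and the M3b process with radius $R$ have the same TCF; (ii) $\displaystyle f(u)=\frac1{\kappa_d}\int_{(0,1/u]}s^d\,dH(s)$ for every $u>0$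 at which $f$ is left-continuous (hence for all but countably many $u>0$); (iii) $\displaystyle H(s)=\kappa_d\int_{(0,s]}\frac1{u^d}\,d\big[f(1/u)\big]$ for every $s>0$, where $d[f(1/u)]$ is the Lebesgue–Stieltjes measure of the non-decreasing function $u\mapsto f(1/u)$ on $(0,\infty)$. Moreover, for every such $f$ there is a random radius $R$ satisfying (iii), and for every random radius $R$ there is such an $f$ satisfying the formula in (ii) for all $u>0$. -/

import Mathlib

open MeasureTheory ProbabilityTheory Filter Topology
open scoped NNReal ENNReal

namespace TailCorr

noncomputable section

/-- The space `ℝ^d` with the Euclidean norm. -/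
abbrev E (d : ℕ) : Type := EuclideanSpace ℝ (Fin d)

/-- The volume `κ_d` of the `d`-dimensional unit ball. -/
def kappa (d : ℕ) : ℝ≥0∞ := volume (Metric.closedBall (0 : E d) 1)

/-! ### Poisson point processes on `(0,∞) × S` and spectral representations -/

/-- The measure `u⁻² du` on `(0,∞)`. -/
def frechetIntensity : Measure ℝ :=
  (volume.restrict (Set.Ioi 0)).withDensity fun u => ENNReal.ofReal ((u ^ 2)⁻¹)

/-- The number of indices `n` with `(U n, W n) ∈ A`. -/
def pointCount {Ω S : Type} (U : ℕ → Ω → ℝ) (W : ℕ → Ω → S) (A : Set (ℝ × S)) (ω : Ω) : ℕ∞ :=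
  {n : ℕ | (U n ω, W n ω) ∈ A}.encard

/-- `(U n, W n)` is an enumerated Poisson point process on `(0,∞) × S` with intensity measure
`u⁻² du × ν`: the number of points in a measurable set of finite intensity is Poisson distributed,
and the numbers of points in disjoint measurable sets are independent.  An index `n` with
`U n ω = 0` carries no point of `(0,∞) × S`, so that the enumeration may skip indices. -/
structure IsPoissonPointProcess {Ω S : Type} [MeasurableSpace Ω] [MeasurableSpace S]
    (P : Measure Ω) (ν : Measure S) (U : ℕ → Ω → ℝ) (W : ℕ → Ω → S) : Prop where
  measurable_fst : ∀ n, Measurable (U n)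
  measurable_snd : ∀ n, Measurable (W n)
  nonneg : ∀ n ω, 0 ≤ U n ω
  poisson : ∀ A : Set (ℝ × S), MeasurableSet A → A ⊆ Set.Ioi 0 ×ˢ Set.univ →
    frechetIntensity.prod ν A ≠ ∞ →
    ∀ k : ℕ, P {ω | pointCount U W A ω = k} =
      poissonMeasure (frechetIntensity.prod ν A).toNNReal {k}
  indep : ∀ (m : ℕ) (A : Fin m → Set (ℝ × S)), (∀ i, MeasurableSet (A i)) →
    (∀ i, A i ⊆ Set.Ioi 0 ×ˢ Set.univ) → Pairwise (fun i j => Disjoint (A i) (A j)) →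
    iIndepFun (fun i => pointCount U W (A i)) P

/-- The process `X` (indexed by `T`) has the spectral representation
`X_t = sup_n U_n V_t(W_n)` in distribution (equality of laws on the product σ-algebra, that is,
equality of all finite-dimensional distributions), where `(U_n, W_n)` is a Poisson point process
with intensity `u⁻² du × ν` on some probability space. -/
def HasSpectralRep {T Ω S : Type} [MeasurableSpace Ω] [MeasurableSpace S]
    (P : Measure Ω) (X : T → Ω → ℝ≥0) (ν : Measure S) (V : T → S → ℝ≥0∞) : Prop :=
  ∃ (Ω' : Type) (_ : MeasurableSpace Ω') (P' : Measure Ω') (U : ℕ → Ω' → ℝ) (W : ℕ → Ω' → S),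
    IsProbabilityMeasure P' ∧ IsPoissonPointProcess P' ν U W ∧
    IdentDistrib (fun ω t => (X t ω : ℝ≥0∞))
      (fun ω' t => ⨆ n, ENNReal.ofReal (U n ω') * V t (W n ω')) P P'

/-! ### Mixed moving maxima processes -/

/-- `f` is a measurable process on `ℝ^d` with values in `[0,∞]`, defined on the probability
space `(F, Q)`, such that the expectation of `∫ f(t) dt` is `1`. -/
structure IsRandomShape {F : Type} [MeasurableSpace F] (d : ℕ) (Q : Measure F)
    (f : F → E d → ℝ≥0∞) : Prop where
  isProb : IsProbabilityMeasure Q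
  measurable : Measurable (Function.uncurry f)
  integral_eq_one : ∫⁻ a, (∫⁻ x : E d, f a x) ∂Q = 1

/-- `X` is the mixed moving maxima process with random shape `f`: its spectral functions on
`(ℝ^d × F, dz × Q)` are `V_t(z, a) = f_a(t - z)`. -/
def IsM3Process {F Ω : Type} [MeasurableSpace F] [MeasurableSpace Ω] (d : ℕ) (Q : Measure F)
    (f : F → E d → ℝ≥0∞) (P : Measure Ω) (X : E d → Ω → ℝ≥0) : Prop :=
  IsRandomShape d Q f ∧
    HasSpectralRep P X ((volume : Measure (E d)).prod Q) (fun t p => f p.2 (t - p.1))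

/-- `χ` is the tail correlation function of `X`:
`χ(t) = lim_{τ → ∞} P(X_t ≥ τ | X_o ≥ τ)` (the marginals considered here are standard Fréchet, so
their upper endpoint is `∞`). -/
def IsTCF {Ω : Type} [MeasurableSpace Ω] {d : ℕ} (P : Measure Ω) (X : E d → Ω → ℝ≥0)
    (χ : E d → ℝ) : Prop :=
  ∀ t, Tendsto (fun τ : ℝ≥0 => (P[|{ω | τ ≤ X 0 ω}]).real {ω | τ ≤ X t ω}) atTop (𝓝 (χ t))

/-- `χ` is the tail correlation function of an M3 process with random shape `f`. -/
def IsM3TCF {F : Type} [MeasurableSpace F] (d : ℕ) (Q : Measure F) (f : F → E d → ℝ≥0∞)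
    (χ : E d → ℝ) : Prop :=
  ∃ (Ω : Type) (_ : MeasurableSpace Ω) (P : Measure Ω) (X : E d → Ω → ℝ≥0),
    IsProbabilityMeasure P ∧ IsM3Process d Q f P X ∧ IsTCF P X χ

/-- The radial function on `ℝ^d` given by a function on `[0,∞)`. -/
def radial (d : ℕ) {α : Type} (g : ℝ≥0 → α) : E d → α := fun x => g ‖x‖₊

/-- The normalized indicator function of the closed ball of radius `r` around the origin. -/
def ballShape (d : ℕ) (r : ℝ) : E d → ℝ≥0∞ :=
  (Metric.closedBall (0 : E d) r).indicator
    fun _ => (volume (Metric.closedBall (0 : E d) r))⁻¹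

/-- `R` is a random variable on the probability space `(F, Q)` with values in `(0,∞)`. -/
structure IsRandomRadius {F : Type} [MeasurableSpace F] (Q : Measure F) (R : F → ℝ) : Prop where
  isProb : IsProbabilityMeasure Q
  measurable : Measurable R
  pos : ∀ a, 0 < R a

/-- `χ` is the tail correlation function of a moving maxima process with the deterministic radial
shape `x ↦ g ‖x‖`. -/
def IsM2rTCF (d : ℕ) (g : ℝ≥0 → ℝ≥0∞) (χ : E d → ℝ) : Prop :=
  IsM3TCF d (Measure.dirac ()) (fun _ : Unit => radial d g) χ

/-- `χ` is the tail correlation function of the M3 process of normalized indicators of balls with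
random radius `R`. -/
def IsM3bTCF {F : Type} [MeasurableSpace F] (d : ℕ) (Q : Measure F) (R : F → ℝ)
    (χ : E d → ℝ) : Prop :=
  IsM3TCF d Q (fun a => ballShape d (R a)) χ

/-- Tail correlation functions of M3 processes all of whose shape realizations are radial and
non-increasing in the radius. -/
def tcfM3r (d : ℕ) : Set (E d → ℝ) :=
  {χ | ∃ (F : Type) (_ : MeasurableSpace F) (Q : Measure F) (f : F → E d → ℝ≥0∞),
    (∀ a, ∃ g : ℝ≥0 → ℝ≥0∞, Antitone g ∧ f a = radial d g) ∧ IsM3TCF d Q f χ}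

/-- Tail correlation functions of M2 processes with a deterministic radial non-increasing shape. -/
def tcfM2r (d : ℕ) : Set (E d → ℝ) :=
  {χ | ∃ g : ℝ≥0 → ℝ≥0∞, Antitone g ∧ IsM2rTCF d g χ}

/-- Tail correlation functions of M3 processes of normalized ball indicators. -/
def tcfM3b (d : ℕ) : Set (E d → ℝ) :=
  {χ | ∃ (F : Type) (_ : MeasurableSpace F) (Q : Measure F) (R : F → ℝ),
    IsRandomRadius Q R ∧ IsM3bTCF d Q R χ}

/-! ### Gneiting's class `H_d` -/

/-- `h_d(t) = d Γ(d/2) / (√π Γ((d+1)/2)) ∫_t^1 (1 - v²)_+^{(d-1)/2} dv` for `t ≥ 0`; it vanishes for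
`t ≥ 1`. -/
def hFun (d : ℕ) (t : ℝ) : ℝ :=
  d * Real.Gamma (d / 2) / (√Real.pi * Real.Gamma ((d + 1) / 2)) *
    ∫ v in Set.Icc t 1, (1 - v ^ 2) ^ (((d : ℝ) - 1) / 2)

/-- The class `H_d` of functions `φ(t) = ∫_{(0,∞)} h_d(s t) dG(s)` on `[0,∞)`, where `G` is a
probability distribution on `(0,∞)`. -/
def gneitingClass (d : ℕ) : Set (ℝ≥0 → ℝ) :=
  {φ | ∃ G : Measure ℝ, IsProbabilityMeasure G ∧ G (Set.Iic 0) = 0 ∧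
    ∀ t : ℝ≥0, φ t = ∫ s in Set.Ioi 0, hFun d (s * t) ∂G}

/-! ### The correspondence between shapes and radii -/

/-- `g` is the shape of an M2r process: non-increasing on `[0,∞)` with `∫_{ℝ^d} g(‖x‖) dx = 1`. -/
structure IsM2rShape (d : ℕ) (g : ℝ≥0 → ℝ≥0∞) : Prop where
  antitone : Antitone g
  integral_eq_one : ∫⁻ x, radial d g x = 1

/-- The function `u ↦ g(1/u)` on `(0,∞)`, extended by `0` to `(-∞,0]`. -/
def recipFun (g : ℝ≥0 → ℝ≥0∞) (u : ℝ) : ℝ := if u ≤ 0 then 0 else (g (u⁻¹).toNNReal).toReal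

theorem IsM2rShape.ne_top {d : ℕ} {g : ℝ≥0 → ℝ≥0∞} (hg : IsM2rShape d g) {r : ℝ≥0} (hr : 0 < r) :
    g r ≠ ∞ := by
  intro h
  have h1 : ∫⁻ x, radial d g x = ∞ := by
    refine top_le_iff.1 ?_
    calc (∞ : ℝ≥0∞) = ∞ * volume (Metric.closedBall (0 : E d) r) :=
          (ENNReal.top_mul (Metric.measure_closedBall_pos volume _ (by exact_mod_cast hr)).ne').symm
      _ = ∫⁻ _ in Metric.closedBall (0 : E d) r, ∞ := by rw [setLIntegral_const]
      _ ≤ ∫⁻ x in Metric.closedBall (0 : E d) r, radial d g x := by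
          refine setLIntegral_mono' Metric.isClosed_closedBall.measurableSet fun x hx => ?_
          rw [← h]
          refine hg.antitone ?_
          rw [← NNReal.coe_le_coe, coe_nnnorm]
          simpa using hx
      _ ≤ ∫⁻ x, radial d g x := setLIntegral_le_lintegral _ _
  simp [hg.integral_eq_one] at h1

theorem IsM2rShape.monotone_recipFun {d : ℕ} {g : ℝ≥0 → ℝ≥0∞} (hg : IsM2rShape d g) :
    Monotone (recipFun g) := by
  intro u v huv
  unfold recipFun
  split_ifs with hu hv hv
  · exact le_rfl
  · exact ENNReal.toReal_nonneg
  · exact absurd (huv.trans hv) hu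
  · push Not at hu hv
    refine ENNReal.toReal_mono (hg.ne_top (by simpa using hv)) (hg.antitone ?_)
    exact Real.toNNReal_le_toNNReal (inv_anti₀ hu huv)

/-- The Lebesgue–Stieltjes measure `d[g(1/u)]`. -/
def shapeMeasure {d : ℕ} {g : ℝ≥0 → ℝ≥0∞} (hg : IsM2rShape d g) : Measure ℝ :=
  hg.monotone_recipFun.stieltjesFunction.measure

/-- `(1/κ_d) ∫_{(0,1/u]} s^d dH(s)`. -/
def shapeOfCdf (d : ℕ) (H : StieltjesFunction ℝ) (u : ℝ≥0) : ℝ≥0∞ :=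
  (kappa d)⁻¹ * ∫⁻ s in Set.Ioc 0 (u : ℝ)⁻¹, ENNReal.ofReal (s ^ d) ∂H.measure

/-- `κ_d ∫_{(0,s]} u^{-d} d[g(1/u)]`. -/
def cdfOfShape {d : ℕ} {g : ℝ≥0 → ℝ≥0∞} (hg : IsM2rShape d g) (s : ℝ) : ℝ≥0∞ :=
  kappa d * ∫⁻ u in Set.Ioc 0 s, ENNReal.ofReal ((u ^ d)⁻¹) ∂(shapeMeasure hg)

/-- The distribution function `H` of `1/R`. -/
def cdfInv {F : Type} [MeasurableSpace F] (Q : Measure F) (R : F → ℝ) : StieltjesFunction ℝ :=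
  cdf (Q.map fun a => (R a)⁻¹)

end

end TailCorr

open TailCorr

namespace TailCorr

noncomputable section

/-! The spectral supremum is at most `τ` exactly when a Poisson process has no point in a set of
intensity `τ⁻¹ ∫ V dν`, which has probability `exp(-∫ V dν / τ)`. Using this for `V_o`, `V_t` and
`max(V_o, V_t)`, inclusion–exclusion gives the TCF `∫ min(V_o, V_t) dν`, which for an M3 process is
`E ∫ min(f(-z), f(t-z)) dz` (`isM3TCF_iff`). Exhibiting a process with a given random shape also
needs the existence of Poisson processes (`exists_isPoissonPointProcess`).

For a non-increasing radial profile `g` the integrand is `g(max(‖z‖, ‖t-z‖))`, which is linear in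
`g`. A random profile may therefore be replaced by its mean, so M3r = M2r. For a ball of radius `R`
the overlap is the relative volume of a lens, namely `h_d(‖t‖/(2R))` (`volume_lens`), so M3b is
`H_d`, with `G` the law of `1/(2R)`.

Every profile is a mixture of normalized ball indicators: up to its values at discontinuities,
`g(u)` is the mass of `(0,1/u]` under `d[g(1/s)]`, and `dH(s) = κ_d s^{-d} d[g(1/s)]` has total mass
one by Tonelli (`IsM2rShape.lintegral_shapeMeasure`). This gives M2r ⊆ M3b and (iii) ⇒ (i); (ii) ⇔
(iii) is the inversion of a density.

For (i) ⇒ (iii) the law of `R` must be recovered from the TCF. As a function of `t ≥ 0`, `E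
h_d(t/(2R))` is the survival function of `2RV`, with `V` independent of `R` and having survival
function `h_d`. After taking logarithms the characteristic functions multiply; that of `log V` is a
Beta integral without zeros and can be cancelled (`IsRandomRadius.map_eq_map`). -/

/-! ### Laws of counting variables -/

/-- The weight `2⁻ⁿ` of an extended natural number `n`. -/
def halfPow (n : ℕ∞) : ℝ := ENat.recTopCoe 0 (fun k => (1 / 2 : ℝ) ^ k) n

@[simp] theorem halfPow_top : halfPow ⊤ = 0 := rfl

@[simp] theorem halfPow_coe (n : ℕ) : halfPow n = (1 / 2 : ℝ) ^ n := rfl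

theorem halfPow_mem_Icc (n : ℕ∞) : halfPow n ∈ Set.Icc (0 : ℝ) 1 := by
  induction n using ENat.recTopCoe with
  | top => simp
  | coe n =>
    rw [halfPow_coe]
    exact ⟨by positivity, pow_le_one₀ (by norm_num) (by norm_num)⟩

/-- By injectivity `halfPow` encodes `ℕ∞`, including `⊤`, in the compact interval `[0,1]`, where
moments determine laws. -/
theorem halfPow_injective : Function.Injective halfPow := by
  intro m n h
  induction m using ENat.recTopCoe with
  | top =>
    induction n using ENat.recTopCoe with
    | top => rfl
    | coe n => exact (pow_ne_zero n (by norm_num) h.symm).elim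
  | coe m =>
    induction n using ENat.recTopCoe with
    | top => exact (pow_ne_zero m (by norm_num) h).elim
    | coe n =>
      simp only [halfPow_coe] at h
      exact congrArg _ (pow_right_injective₀ (by norm_num) (by norm_num) h)

/-- Finite measures on the unit cube are determined by their moments. -/
theorem ext_of_integral_monomial {ι : Type} [Fintype ι]
    {μ ν : Measure (ι → Set.Icc (0 : ℝ) 1)} [IsFiniteMeasure μ] [IsFiniteMeasure ν]
    (h : ∀ s : ι → ℕ, ∫ x, ∏ i, (x i : ℝ) ^ s i ∂μ = ∫ x, ∏ i, (x i : ℝ) ^ s i ∂ν) : μ = ν := by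
  let c : ι → BoundedContinuousFunction (ι → Set.Icc (0 : ℝ) 1) ℝ := fun i =>
    BoundedContinuousFunction.mkOfCompact ⟨fun x => (x i : ℝ), by fun_prop⟩
  -- The polynomials in the coordinates form a subalgebra that separates points, so testing on them
  -- suffices.
  let A : StarSubalgebra ℝ (BoundedContinuousFunction (ι → Set.Icc (0 : ℝ) 1) ℝ) :=
    { (MvPolynomial.aeval (R := ℝ) c).range with
      star_mem' := fun {a} ha => by
        have : star a = a := by ext x; simp
        rwa [this] }
  refine ext_of_forall_mem_subalgebra_integral_eq_of_polish (𝕜 := ℝ) (A := A) ?_ ?_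
  · intro x y hxy
    obtain ⟨i, hi⟩ := Function.ne_iff.1 hxy
    refine ⟨fun z => (z i : ℝ), ⟨_, ⟨c i, ⟨MvPolynomial.X i, by simp⟩, rfl⟩, rfl⟩, ?_⟩
    simpa [Subtype.ext_iff] using hi
  · rintro g ⟨p, rfl⟩
    have key : ∀ p : MvPolynomial ι ℝ, ∀ x, (MvPolynomial.aeval (R := ℝ) c p) x =
        ∑ m ∈ p.support, p.coeff m * ∏ i, (x i : ℝ) ^ m i := by
      intro p x
      rw [MvPolynomial.aeval_def, MvPolynomial.eval₂_eq']
      simp [c, BoundedContinuousFunction.algebraMap_apply, Finset.prod_apply]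
    have hint : ∀ (ρ : Measure (ι → Set.Icc (0 : ℝ) 1)) [IsFiniteMeasure ρ] (s : ι → ℕ),
        Integrable (fun x => ∏ i, (x i : ℝ) ^ s i) ρ := by
      intro ρ _ s
      exact (BoundedContinuousFunction.mkOfCompact
        ⟨fun x : ι → Set.Icc (0 : ℝ) 1 => ∏ i, (x i : ℝ) ^ s i, by fun_prop⟩).integrable ρ
    change ∫ x, (MvPolynomial.aeval (R := ℝ) c p) x ∂μ = ∫ x, (MvPolynomial.aeval (R := ℝ) c p) x ∂ν
    simp only [key]
    have hint' : ∀ (ρ : Measure (ι → Set.Icc (0 : ℝ) 1)) [IsFiniteMeasure ρ], ∀ m ∈ p.support,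
        Integrable (fun x => p.coeff m * ∏ i, (x i : ℝ) ^ m i) ρ :=
      fun ρ _ m _ => (hint ρ m).const_mul _
    rw [integral_finsetSum _ (hint' μ), integral_finsetSum _ (hint' ν)]
    simp only [integral_const_mul, h]

/-- The joint law of finitely many counting variables is determined by the mixed moments of
their weights. -/
theorem ext_of_integral_halfPow {ι : Type} [Fintype ι] {μ ν : Measure (ι → ℕ∞)}
    [IsFiniteMeasure μ] [IsFiniteMeasure ν]
    (h : ∀ s : ι → ℕ, ∫ x, ∏ i, halfPow (x i) ^ s i ∂μ = ∫ x, ∏ i, halfPow (x i) ^ s i ∂ν) :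
    μ = ν := by
  let Φ : (ι → ℕ∞) → (ι → Set.Icc (0 : ℝ) 1) := fun x i => ⟨halfPow (x i), halfPow_mem_Icc _⟩
  have hΦ : Measurable Φ := measurable_pi_lambda _ fun i =>
    (Measurable.of_discrete (f := fun n : ℕ∞ =>
      (⟨halfPow n, halfPow_mem_Icc n⟩ : Set.Icc (0 : ℝ) 1))).comp (measurable_pi_apply i)
  have hinj : Function.Injective Φ := fun x y hxy => funext fun i =>
    halfPow_injective (congrArg Subtype.val (congrFun hxy i))
  have hmap : μ.map Φ = ν.map Φ := by
    refine ext_of_integral_monomial fun s => ?_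
    rw [integral_map hΦ.aemeasurable, integral_map hΦ.aemeasurable]
    · exact h s
    · exact Measurable.aestronglyMeasurable (by fun_prop)
    · exact Measurable.aestronglyMeasurable (by fun_prop)
  -- The space `ι → ℕ∞` is countable, so a measure on it is determined by its singletons.
  refine Measure.ext_of_singleton fun x => ?_
  have hx : {x} = Φ ⁻¹' {Φ x} := by
    ext y
    simp [hinj.eq_iff]
  rw [hx, ← Measure.map_apply hΦ (measurableSet_singleton _), hmap,
    Measure.map_apply hΦ (measurableSet_singleton _)]

/-! ### Existence of Poisson point processes -/

theorem halfPow_antitone : Antitone halfPow := by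
  intro m n h
  induction n using ENat.recTopCoe with
  | top => exact (halfPow_mem_Icc m).1
  | coe n =>
    induction m using ENat.recTopCoe with
    | top => exact absurd h (by simp)
    | coe m =>
      exact pow_le_pow_of_le_one (by norm_num) (by norm_num) (by exact_mod_cast h)

/-- This allows counting in a superposition of infinitely many layers by counting in finitely many.
When `T` is infinite, the `S K` eventually contain any given `M` elements of `T`, which pushes the
weight below `2⁻ᴹ`. -/
theorem tendsto_halfPow_encard {T : Set ℕ} {S : ℕ → Set ℕ} (hS : Monotone S)
    (hT : ⋃ K, S K = T) : Tendsto (fun K => halfPow (S K).encard) atTop (𝓝 (halfPow T.encard)) := by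
  have hsub : ∀ s : Set ℕ, s.Finite → s ⊆ T → ∀ᶠ K in atTop, s ⊆ S K := by
    intro s hs hsT
    refine (Filter.eventually_all_finite hs).2 fun n hn => ?_
    obtain ⟨K, hK⟩ := Set.mem_iUnion.1 (hT.ge (hsT hn))
    filter_upwards [eventually_ge_atTop K] with L hL using hS hL hK
  by_cases hfin : T.Finite
  · refine tendsto_const_nhds.congr' ?_
    filter_upwards [hsub T hfin subset_rfl] with K hK
    rw [Set.Subset.antisymm (hT ▸ Set.subset_iUnion S K) hK]
  · rw [Set.Infinite.encard_eq hfin, halfPow_top]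
    refine tendsto_order.2 ⟨fun a ha => Eventually.of_forall fun K =>
      ha.trans_le (halfPow_mem_Icc _).1, fun a ha => ?_⟩
    obtain ⟨M, hM⟩ := exists_pow_lt_of_lt_one ha (by norm_num : (1 / 2 : ℝ) < 1)
    obtain ⟨t, htT, rfl⟩ := Set.Infinite.exists_subset_card_eq hfin M
    filter_upwards [hsub t t.finite_toSet htT] with K hK
    refine lt_of_le_of_lt ?_ hM
    rw [← halfPow_coe]
    refine halfPow_antitone ?_
    rw [← Set.encard_coe_eq_coe_finsetCard]
    exact Set.encard_le_encard hK

theorem integral_prod_range_infinitePi {Y : Type} [MeasurableSpace Y] (p : Measure Y)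
    [IsProbabilityMeasure p] {φ : Y → ℝ} (hφ : Measurable φ) (n : ℕ) :
    ∫ y, ∏ j ∈ Finset.range n, φ (y j) ∂(Measure.infinitePi fun _ : ℕ => p) =
      (∫ x, φ x ∂p) ^ n := by
  have hind : iIndepFun (fun (i : Fin n) (y : ℕ → Y) => y i)
      (Measure.infinitePi fun _ : ℕ => p) :=
    (iIndepFun_infinitePi (P := fun _ : ℕ => p) (X := fun _ x => x)
      fun _ => measurable_id).precomp Fin.val_injective
  simp only [Finset.prod_range]
  rw [hind.integral_fun_prod_comp (f := fun _ => φ) (fun i => (measurable_pi_apply _).aemeasurable)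
    fun i => hφ.aestronglyMeasurable]
  have : ∀ i : ℕ, ∫ y, φ (y i) ∂(Measure.infinitePi fun _ : ℕ => p) = ∫ x, φ x ∂p := by
    intro i
    conv_rhs => rw [← Measure.infinitePi_map_eval (fun _ : ℕ => p) i]
    rw [integral_map (measurable_pi_apply _).aemeasurable hφ.aestronglyMeasurable]
  simp [this]

/-- A Poisson number of points together with an independent sequence of independent
points. -/
def layerMeasure {Y : Type} [MeasurableSpace Y] (p : Measure Y) [IsProbabilityMeasure p] (m : ℝ≥0) :
    Measure (ℕ × (ℕ → Y)) :=
  (poissonMeasure m).prod (Measure.infinitePi fun _ : ℕ => p)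

instance {Y : Type} [MeasurableSpace Y] (p : Measure Y) [IsProbabilityMeasure p] (m : ℝ≥0) :
    IsProbabilityMeasure (layerMeasure p m) := by
  unfold layerMeasure
  infer_instance

theorem measurable_layer_prod {Y : Type} [MeasurableSpace Y] {φ : Y → ℝ} (hφ : Measurable φ) :
    Measurable fun l : ℕ × (ℕ → Y) => ∏ j ∈ Finset.range l.1, φ (l.2 j) := by
  refine measurable_from_prod_countable_right fun n => ?_
  exact Finset.measurable_fun_prod (Finset.range n) fun j _ => hφ.comp (measurable_pi_apply j)

theorem integral_pow_poissonMeasure (m : ℝ≥0) (q : ℝ) :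
    ∫ n : ℕ, q ^ n ∂(poissonMeasure m) = Real.exp (-(m * (1 - q))) := by
  rw [integral_poissonMeasure]
  have : ∀ n : ℕ, (Real.exp (-m) * (m : ℝ) ^ n / (n.factorial : ℝ)) • q ^ n =
      Real.exp (-m) * ((m * q) ^ n / n.factorial) := by
    intro n
    rw [mul_pow, smul_eq_mul]
    ring
  simp only [this]
  rw [tsum_mul_left, (NormedSpace.expSeries_div_hasSum_exp (m * q)).tsum_eq,
    ← Real.exp_eq_exp_ℝ, ← Real.exp_add]
  congr 1
  ring

/-- Given `n` points the mean of the product is `(∫ φ)^n`; averaging over a Poisson number `n` is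
evaluating the Poisson generating function at `∫ φ`. -/
theorem integral_layerMeasure_prod {Y : Type} [MeasurableSpace Y] (p : Measure Y)
    [IsProbabilityMeasure p] (m : ℝ≥0) {φ : Y → ℝ} (hφ : Measurable φ)
    (h01 : ∀ y, φ y ∈ Set.Icc (0 : ℝ) 1) :
    ∫ l, ∏ j ∈ Finset.range l.1, φ (l.2 j) ∂(layerMeasure p m) =
      Real.exp (-(m * (1 - ∫ x, φ x ∂p))) := by
  have hint : Integrable (fun l : ℕ × (ℕ → Y) => ∏ j ∈ Finset.range l.1, φ (l.2 j))
      (layerMeasure p m) := by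
    refine Integrable.of_bound (measurable_layer_prod hφ).aestronglyMeasurable 1
      (Eventually.of_forall fun l => ?_)
    rw [Real.norm_of_nonneg (Finset.prod_nonneg fun j _ => (h01 _).1)]
    exact Finset.prod_le_one (fun j _ => (h01 _).1) fun j _ => (h01 _).2
  unfold layerMeasure at hint ⊢
  rw [integral_prod _ hint]
  simp only [integral_prod_range_infinitePi p hφ]
  exact integral_pow_poissonMeasure m _

theorem exists_normalization {Y : Type} [MeasurableSpace Y] [Nonempty Y] (μ : Measure Y)
    [IsFiniteMeasure μ] : ∃ p : Measure Y, IsProbabilityMeasure p ∧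
      ∀ A, μ.real A = (μ Set.univ).toNNReal * p.real A := by
  let μ' : FiniteMeasure Y := ⟨μ, inferInstance⟩
  refine ⟨μ'.normalize, inferInstance, fun A => ?_⟩
  have := congrArg NNReal.toReal (μ'.self_eq_mass_mul_normalize A)
  exact this

/-- The number of the points of a layer that lie in `A`. -/
def layerCount {Y : Type} (A : Set Y) (l : ℕ × (ℕ → Y)) : ℕ :=
  {j | j < l.1 ∧ l.2 j ∈ A}.ncard

open scoped Classical in
theorem halfPow_layerCount {Y : Type} (A : Set Y) (l : ℕ × (ℕ → Y)) :
    (1 / 2 : ℝ) ^ layerCount A l =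
      ∏ j ∈ Finset.range l.1, if l.2 j ∈ A then (1 / 2 : ℝ) else 1 := by
  have : {j | j < l.1 ∧ l.2 j ∈ A} = (({j ∈ Finset.range l.1 | l.2 j ∈ A} : Finset ℕ) : Set ℕ) := by
    ext j; simp
  rw [layerCount, this, Set.ncard_coe_finset, Finset.prod_ite]
  simp

/-- The limit of the weights of the layers is the weight of the whole set of points. -/
theorem tendsto_prod_layerCount {Y : Type} (A : Set Y) (ω : ℕ → ℕ × (ℕ → Y)) :
    Tendsto (fun K => ∏ k ∈ Finset.range K, (1 / 2 : ℝ) ^ layerCount A (ω k)) atTop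
      (𝓝 (halfPow {n : ℕ | n.unpair.2 < (ω n.unpair.1).1 ∧
        (ω n.unpair.1).2 n.unpair.2 ∈ A}.encard)) := by
  set T := {n : ℕ | n.unpair.2 < (ω n.unpair.1).1 ∧ (ω n.unpair.1).2 n.unpair.2 ∈ A}
  have hS : Monotone fun K : ℕ => {n ∈ T | n.unpair.1 < K} := fun K L hKL n hn =>
    ⟨hn.1, hn.2.trans_le hKL⟩
  have hT : ⋃ K : ℕ, {n ∈ T | n.unpair.1 < K} = T := by
    ext n
    simp only [Set.mem_iUnion]
    exact ⟨fun ⟨K, hK⟩ => hK.1, fun h => ⟨n.unpair.1 + 1, h, Nat.lt_succ_self _⟩⟩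
  refine (tendsto_halfPow_encard hS hT).congr fun K => ?_
  have hcard : {n ∈ T | n.unpair.1 < K}.encard =
      ((∑ k ∈ Finset.range K, layerCount A (ω k) : ℕ) : ℕ∞) := by
    induction K with
    | zero => simp
    | succ K ih =>
      -- Point `j` of layer `k` has index `Nat.pair k j`, so distinct layers occupy disjoint sets of
      -- indices.
      have hsplit : {n ∈ T | n.unpair.1 < K + 1} = {n ∈ T | n.unpair.1 < K} ∪
          (Nat.pair K) '' {j | j < (ω K).1 ∧ (ω K).2 j ∈ A} := by
        ext n
        simp only [Set.mem_ofPred_eq, Set.mem_union, Set.mem_image, Nat.lt_succ_iff_lt_or_eq,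
          and_or_left]
        refine or_congr_right ⟨fun h => ⟨n.unpair.2, ?_, ?_⟩, ?_⟩
        · rw [← h.2]; exact h.1
        · rw [← h.2]; exact Nat.pair_unpair n
        · rintro ⟨j, hj, rfl⟩
          simpa [T] using hj
      have hdisj : Disjoint {n ∈ T | n.unpair.1 < K}
          ((Nat.pair K) '' {j | j < (ω K).1 ∧ (ω K).2 j ∈ A}) := by
        rw [Set.disjoint_left]
        rintro _ ⟨_, h⟩ ⟨j, _, rfl⟩
        simp at h
      rw [hsplit, Set.encard_union_eq hdisj, ih, Finset.sum_range_succ,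
        Function.Injective.encard_image fun a b h => (Nat.pair_eq_pair.1 h).2,
        ← Set.Finite.cast_ncard_eq ((Set.finite_lt_nat _).subset fun j hj => hj.1)]
      push_cast
      rfl
  rw [hcard, halfPow_coe, Finset.prod_pow_eq_pow_sum]

/-- The probability space of the Poisson point process with intensity `∑ k, m k • p k`. -/
def layersMeasure {Y : Type} [MeasurableSpace Y] (p : ℕ → Measure Y)
    [∀ k, IsProbabilityMeasure (p k)] (m : ℕ → ℝ≥0) : Measure (ℕ → ℕ × (ℕ → Y)) :=
  Measure.infinitePi fun k => layerMeasure (p k) (m k)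

instance {Y : Type} [MeasurableSpace Y] (p : ℕ → Measure Y) [∀ k, IsProbabilityMeasure (p k)]
    (m : ℕ → ℝ≥0) : IsProbabilityMeasure (layersMeasure p m) := by
  unfold layersMeasure
  infer_instance

theorem integral_layersMeasure_prod {Y : Type} [MeasurableSpace Y] (p : ℕ → Measure Y)
    [∀ k, IsProbabilityMeasure (p k)] (m : ℕ → ℝ≥0) {Ψ : ℕ × (ℕ → Y) → ℝ} (hΨ : Measurable Ψ)
    (K : ℕ) : ∫ ω, ∏ k ∈ Finset.range K, Ψ (ω k) ∂(layersMeasure p m) =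
      ∏ k ∈ Finset.range K, ∫ l, Ψ l ∂(layerMeasure (p k) (m k)) := by
  have hind : iIndepFun (fun (i : Fin K) (ω : ℕ → ℕ × (ℕ → Y)) => ω i) (layersMeasure p m) :=
    (iIndepFun_infinitePi (P := fun k : ℕ => layerMeasure (p k) (m k)) (X := fun _ x => x)
      fun _ => measurable_id).precomp Fin.val_injective
  simp only [Finset.prod_range]
  rw [hind.integral_fun_prod_comp (f := fun _ => Ψ) (fun i => (measurable_pi_apply _).aemeasurable)
    fun i => hΨ.aestronglyMeasurable]
  refine Finset.prod_congr rfl fun i _ => ?_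
  conv_rhs => rw [← Measure.infinitePi_map_eval (fun k : ℕ => layerMeasure (p k) (m k)) i]
  rw [integral_map (measurable_pi_apply _).aemeasurable hΨ.aestronglyMeasurable]
  rfl

/-- The number of points of all layers that lie in `A`. -/
def layersCount {Y : Type} (A : Set Y) (ω : ℕ → ℕ × (ℕ → Y)) : ℕ∞ :=
  {n : ℕ | n.unpair.2 < (ω n.unpair.1).1 ∧ (ω n.unpair.1).2 n.unpair.2 ∈ A}.encard

theorem measurable_halfPow_layerCount {Y : Type} [MeasurableSpace Y] {A : Set Y}
    (hA : MeasurableSet A) : Measurable fun l : ℕ × (ℕ → Y) => (1 / 2 : ℝ) ^ layerCount A l := by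
  classical
  simp only [halfPow_layerCount]
  exact measurable_layer_prod (φ := fun y => if y ∈ A then (1 / 2 : ℝ) else 1)
    (Measurable.ite hA measurable_const measurable_const)

theorem measurable_layersCount {Y : Type} [MeasurableSpace Y] {A : Set Y} (hA : MeasurableSet A) :
    Measurable (layersCount A : (ℕ → ℕ × (ℕ → Y)) → ℕ∞) := by
  have h1 : Measurable fun ω : ℕ → ℕ × (ℕ → Y) => halfPow (layersCount A ω) :=
    measurable_of_tendsto_metrizable (fun K => Finset.measurable_fun_prod (Finset.range K)
      fun k _ => (measurable_halfPow_layerCount hA).comp (measurable_pi_apply k))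
      (tendsto_pi_nhds.2 fun ω => tendsto_prod_layerCount A ω)
  refine measurable_to_countable' fun n => ?_
  have : layersCount A ⁻¹' {n} = (fun ω : ℕ → ℕ × (ℕ → Y) => halfPow (layersCount A ω)) ⁻¹'
      {halfPow n} := by
    ext ω
    simp [halfPow_injective.eq_iff]
  rw [this]
  exact h1 (measurableSet_singleton _)

/-- The expectation of `2 ^ (-s N)` for a Poisson variable `N` with mean `x`. -/
def poissonMoment (x : ℝ≥0∞) (s : ℕ) : ℝ :=
  -- For `x = ∞` the count is almost surely infinite with weight `0`, but the power `0 ^ 0` is `1`;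
  -- hence the order of the cases.
  if s = 0 then 1 else if x = ∞ then 0 else Real.exp (-((1 - (1 / 2 : ℝ) ^ s) * x.toReal))

theorem tendsto_poissonMoment {a : ℕ → ℝ≥0∞} (ha : ∀ k, a k ≠ ∞) (s : ℕ) :
    Tendsto (fun K => Real.exp (-((1 - (1 / 2 : ℝ) ^ s) * ∑ k ∈ Finset.range K, (a k).toReal)))
      atTop (𝓝 (poissonMoment (∑' k, a k) s)) := by
  unfold poissonMoment
  have hsum : ∀ K, ∑ k ∈ Finset.range K, (a k).toReal = (∑ k ∈ Finset.range K, a k).toReal :=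
    fun K => (ENNReal.toReal_sum fun k _ => ha k).symm
  split_ifs with hs hx
  · simp [hs]
  · have hpos : 0 < 1 - (1 / 2 : ℝ) ^ s := by
      have := pow_lt_one₀ (by norm_num : (0 : ℝ) ≤ 1 / 2) (by norm_num) hs
      linarith
    refine Real.tendsto_exp_atBot.comp (tendsto_neg_atTop_atBot.comp
      (Tendsto.const_mul_atTop hpos ?_))
    have h := ENNReal.tendsto_nat_tsum a
    rw [hx] at h
    refine tendsto_atTop.2 fun b => ?_
    filter_upwards [h.eventually (lt_mem_nhds (ENNReal.ofReal_lt_top (r := b)))] with K hK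
    rw [hsum]
    exact (ENNReal.ofReal_le_iff_le_toReal (ENNReal.sum_ne_top.2 fun k _ => ha k)).1 hK.le
  · refine (Real.continuous_exp.tendsto _).comp (Tendsto.neg (Tendsto.const_mul _ ?_))
    simp only [hsum]
    exact (ENNReal.tendsto_toReal hx).comp (ENNReal.tendsto_nat_tsum a)

-- By disjointness at most one factor differs from `1`. The sum on the right integrates to a sum
-- over `i`, which the exponential later turns into a product; this is the source of independence.
open scoped Classical in
theorem prod_ite_eq_one_sub_sum {Y ι : Type} [Fintype ι] {A : ι → Set Y}
    (hdisj : Pairwise fun i j => Disjoint (A i) (A j)) (c : ι → ℝ) (y : Y) :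
    ∏ i, (if y ∈ A i then c i else 1) = 1 - ∑ i, (A i).indicator (fun _ => 1 - c i) y := by
  by_cases h : ∃ i, y ∈ A i
  · obtain ⟨i, hi⟩ := h
    have hne : ∀ j, j ≠ i → y ∉ A j := fun j hj hy => Set.disjoint_left.1 (hdisj hj) hy hi
    rw [Finset.prod_eq_single i (fun j _ hj => if_neg (hne j hj)) (by simp),
      Finset.sum_eq_single i (fun j _ hj => Set.indicator_of_notMem (hne j hj) _) (by simp),
      if_pos hi, Set.indicator_of_mem hi]
    ring
  · push Not at h
    simp [h]

/-- The mixed moments factor over the disjoint sets and depend only on their intensities, which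
yields the Poisson laws and the independence at once. For finitely many layers it is the product of
the exponentials of `integral_layerMeasure_prod`; dominated convergence then adds the remaining
layers. -/
theorem integral_halfPow_layersCount {Y ι : Type} [MeasurableSpace Y] [Fintype ι]
    {μ : Measure Y} {p : ℕ → Measure Y} [∀ k, IsProbabilityMeasure (p k)] {m : ℕ → ℝ≥0}
    (hμ : ∀ A, MeasurableSet A → μ A = ∑' k, m k * p k A)
    {A : ι → Set Y} (hA : ∀ i, MeasurableSet (A i))
    (hdisj : Pairwise fun i j => Disjoint (A i) (A j)) (s : ι → ℕ) :
    ∫ ω, ∏ i, halfPow (layersCount (A i) ω) ^ s i ∂(layersMeasure p m) =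
      ∏ i, poissonMoment (μ (A i)) (s i) := by
  classical
  let φ : Y → ℝ := fun y => ∏ i, if y ∈ A i then (1 / 2 : ℝ) ^ s i else 1
  have hφm : Measurable φ := Finset.measurable_fun_prod _ fun i _ =>
    Measurable.ite (hA i) measurable_const measurable_const
  have hφ01 : ∀ y, φ y ∈ Set.Icc (0 : ℝ) 1 := by
    intro y
    refine ⟨Finset.prod_nonneg fun i _ => ?_, Finset.prod_le_one (fun i _ => ?_) fun i _ => ?_⟩
    · split_ifs <;> positivity
    · split_ifs <;> positivity
    · split_ifs
      · exact pow_le_one₀ (by norm_num) (by norm_num)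
      · exact le_rfl
  have hφint : ∀ k, 1 - ∫ y, φ y ∂(p k) = ∑ i, (1 - (1 / 2 : ℝ) ^ s i) * (p k).real (A i) := by
    intro k
    have hi : ∀ i ∈ Finset.univ, Integrable
        (fun y => (A i).indicator (fun _ => 1 - (1 / 2 : ℝ) ^ s i) y) (p k) := fun i _ =>
      (integrable_const _).indicator (hA i)
    simp only [φ, prod_ite_eq_one_sub_sum hdisj]
    rw [integral_sub (integrable_const _) (integrable_finsetSum _ hi), integral_finsetSum _ hi]
    simp [integral_indicator_const _ (hA _), mul_comm]
  have hfactor : ∀ l : ℕ × (ℕ → Y), ∏ i, ((1 / 2 : ℝ) ^ layerCount (A i) l) ^ s i =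
      ∏ j ∈ Finset.range l.1, φ (l.2 j) := by
    intro l
    simp only [halfPow_layerCount, φ, ← Finset.prod_pow]
    rw [Finset.prod_comm]
    refine Finset.prod_congr rfl fun j _ => Finset.prod_congr rfl fun i _ => ?_
    split_ifs <;> simp
  have hlim1 : Tendsto (fun K => ∫ ω, ∏ k ∈ Finset.range K,
      ∏ i, ((1 / 2 : ℝ) ^ layerCount (A i) (ω k)) ^ s i ∂(layersMeasure p m)) atTop
      (𝓝 (∫ ω, ∏ i, halfPow (layersCount (A i) ω) ^ s i ∂(layersMeasure p m))) := by
    refine tendsto_integral_of_dominated_convergence (fun _ => 1) (fun K => ?_)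
      (integrable_const _) (fun K => Eventually.of_forall fun ω => ?_)
      (Eventually.of_forall fun ω => ?_)
    · simp only [hfactor]
      exact (Finset.measurable_fun_prod (Finset.range K) fun k _ =>
        (measurable_layer_prod hφm).comp (measurable_pi_apply k)).aestronglyMeasurable
    · rw [Real.norm_of_nonneg (Finset.prod_nonneg fun k _ => Finset.prod_nonneg fun i _ => by
        positivity)]
      exact Finset.prod_le_one (fun k _ => Finset.prod_nonneg fun i _ => by positivity) fun k _ =>
        Finset.prod_le_one (fun i _ => by positivity) fun i _ => pow_le_one₀ (by positivity)
          (pow_le_one₀ (by norm_num) (by norm_num))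
    · have : ∀ K, ∏ k ∈ Finset.range K, ∏ i, ((1 / 2 : ℝ) ^ layerCount (A i) (ω k)) ^ s i =
          ∏ i, (∏ k ∈ Finset.range K, (1 / 2 : ℝ) ^ layerCount (A i) (ω k)) ^ s i := by
        intro K
        rw [Finset.prod_comm]
        simp only [Finset.prod_pow]
      simp only [this]
      exact tendsto_finsetProd _ fun i _ => (tendsto_prod_layerCount (A i) ω).pow (s i)
  refine tendsto_nhds_unique hlim1 ?_
  have hval : ∀ K, ∫ ω, ∏ k ∈ Finset.range K,
      ∏ i, ((1 / 2 : ℝ) ^ layerCount (A i) (ω k)) ^ s i ∂(layersMeasure p m) =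
      ∏ i, Real.exp (-((1 - (1 / 2 : ℝ) ^ s i) *
        ∑ k ∈ Finset.range K, ((m k : ℝ≥0∞) * p k (A i)).toReal)) := by
    intro K
    simp only [hfactor]
    rw [integral_layersMeasure_prod p m (measurable_layer_prod hφm)]
    simp only [integral_layerMeasure_prod (p _) (m _) hφm hφ01, hφint]
    rw [← Real.exp_sum, ← Real.exp_sum]
    congr 1
    simp only [Finset.sum_neg_distrib, Finset.mul_sum]
    rw [Finset.sum_comm]
    simp only [ENNReal.toReal_mul, ENNReal.coe_toReal, Measure.real]
    congr 1
    refine Finset.sum_congr rfl fun i _ => Finset.sum_congr rfl fun k _ => ?_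
    ring
  simp only [hval]
  refine tendsto_finsetProd _ fun i _ => ?_
  rw [hμ _ (hA i)]
  exact tendsto_poissonMoment (fun k => ENNReal.mul_ne_top ENNReal.coe_ne_top
    (measure_ne_top _ _)) _

theorem map_layersCount_eq_poisson {Y : Type} [MeasurableSpace Y]
    {μ : Measure Y} {p : ℕ → Measure Y} [∀ k, IsProbabilityMeasure (p k)] {m : ℕ → ℝ≥0}
    (hμ : ∀ A, MeasurableSet A → μ A = ∑' k, m k * p k A) {A : Set Y} (hA : MeasurableSet A)
    (hfin : μ A ≠ ∞) (k : ℕ) :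
    layersMeasure p m {ω | layersCount A ω = k} = poissonMeasure (μ A).toNNReal {k} := by
  have h1 : Measurable fun (ω : ℕ → ℕ × (ℕ → Y)) (_ : Unit) => layersCount A ω :=
    measurable_pi_lambda _ fun _ => measurable_layersCount hA
  have h2 : Measurable fun (n : ℕ) (_ : Unit) => (n : ℕ∞) := Measurable.of_discrete
  have hmap : (layersMeasure p m).map (fun ω (_ : Unit) => layersCount A ω) =
      (poissonMeasure (μ A).toNNReal).map (fun (n : ℕ) (_ : Unit) => (n : ℕ∞)) := by
    have := Measure.isProbabilityMeasure_map (μ := layersMeasure p m) h1.aemeasurable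
    have := Measure.isProbabilityMeasure_map (μ := poissonMeasure (μ A).toNNReal) h2.aemeasurable
    refine ext_of_integral_halfPow fun s => ?_
    rw [integral_map h1.aemeasurable Measurable.of_discrete.aestronglyMeasurable,
      integral_map h2.aemeasurable Measurable.of_discrete.aestronglyMeasurable]
    rw [integral_halfPow_layersCount (ι := Unit) hμ (A := fun _ => A) (fun _ => hA)
      (fun i j hij => (hij (Subsingleton.elim i j)).elim) s]
    simp only [Finset.univ_unique, Finset.prod_singleton, halfPow_coe, ← pow_mul]
    simp only [mul_comm _ (s _), pow_mul]
    rw [integral_pow_poissonMeasure, poissonMoment, if_neg hfin]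
    split_ifs with hs
    · simp [hs]
    · rw [mul_comm]
      rfl
  have h3 := congrArg (fun ρ => ρ {x | x () = (k : ℕ∞)}) hmap
  rw [Measure.map_apply h1 (MeasurableSet.of_discrete),
    Measure.map_apply h2 (MeasurableSet.of_discrete)] at h3
  have h4 : {k} = (fun (n : ℕ) (_ : Unit) => (n : ℕ∞)) ⁻¹' {x | x () = (k : ℕ∞)} := by
    ext n
    simp
  rw [h4, ← h3]
  rfl

theorem iIndepFun_layersCount {Y : Type} [MeasurableSpace Y]
    {μ : Measure Y} {p : ℕ → Measure Y} [∀ k, IsProbabilityMeasure (p k)] {m : ℕ → ℝ≥0}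
    (hμ : ∀ A, MeasurableSet A → μ A = ∑' k, m k * p k A) {ι : Type} [Fintype ι]
    {A : ι → Set Y} (hA : ∀ i, MeasurableSet (A i))
    (hdisj : Pairwise fun i j => Disjoint (A i) (A j)) :
    iIndepFun (fun i => layersCount (A i)) (layersMeasure p m) := by
  have hm : ∀ i, AEMeasurable (layersCount (A i)) (layersMeasure p m) := fun i =>
    (measurable_layersCount (hA i)).aemeasurable
  have hm' : Measurable fun ω i => layersCount (Y := Y) (A i) ω :=
    measurable_pi_lambda _ fun i => measurable_layersCount (hA i)
  rw [iIndepFun_iff_map_fun_eq_pi_map hm]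
  have := fun i => Measure.isProbabilityMeasure_map (hm i)
  have := Measure.isProbabilityMeasure_map (μ := layersMeasure p m) hm'.aemeasurable
  refine ext_of_integral_halfPow fun s => ?_
  rw [integral_map hm'.aemeasurable Measurable.of_discrete.aestronglyMeasurable,
    integral_halfPow_layersCount hμ hA hdisj s,
    integral_fintype_prod_eq_prod (f := fun i x => halfPow x ^ s i)]
  refine Finset.prod_congr rfl fun i _ => ?_
  rw [integral_map (hm i) Measurable.of_discrete.aestronglyMeasurable]
  have := integral_halfPow_layersCount (ι := Unit) hμ (A := fun _ => A i) (fun _ => hA i)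
      (fun i j hij => (hij (Subsingleton.elim i j)).elim) (fun _ => s i)
  simpa using this.symm

/-- Poisson point processes with an s-finite spectral measure exist. -/
theorem exists_isPoissonPointProcess {S : Type} [MeasurableSpace S] [Nonempty S] (ν : Measure S)
    [SFinite ν] : ∃ (Ω' : Type) (_ : MeasurableSpace Ω') (P' : Measure Ω') (U : ℕ → Ω' → ℝ)
      (W : ℕ → Ω' → S), IsProbabilityMeasure P' ∧ IsPoissonPointProcess P' ν U W := by
  have : SFinite frechetIntensity := by unfold frechetIntensity; infer_instance
  set μ : Measure (ℝ × S) := frechetIntensity.prod ν with hμdef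
  choose p hp hpμ using fun k => exists_normalization (sfiniteSeq μ k)
  set m : ℕ → ℝ≥0 := fun k => (sfiniteSeq μ k Set.univ).toNNReal
  have hμ : ∀ A, MeasurableSet A → μ A = ∑' k, m k * p k A := by
    intro A hA
    conv_lhs => rw [← sum_sfiniteSeq μ]
    rw [Measure.sum_apply _ hA]
    refine tsum_congr fun k => ?_
    have h := hpμ k A
    rw [← ENNReal.toReal_eq_toReal_iff' (measure_ne_top _ _)
      (ENNReal.mul_ne_top ENNReal.coe_ne_top (measure_ne_top _ _))]
    simpa [Measure.real] using h
  -- Indices beyond the number of points of a layer, and points with nonpositive first coordinate,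
  -- get the value `0`, which carries no point of `(0,∞) × S`.
  let U : ℕ → (ℕ → ℕ × (ℕ → ℝ × S)) → ℝ := fun n ω =>
    if n.unpair.2 < (ω n.unpair.1).1 then max ((ω n.unpair.1).2 n.unpair.2).1 0 else 0
  let W : ℕ → (ℕ → ℕ × (ℕ → ℝ × S)) → S := fun n ω => ((ω n.unpair.1).2 n.unpair.2).2
  have hcount : ∀ A ⊆ Set.Ioi (0 : ℝ) ×ˢ (Set.univ : Set S), pointCount U W A = layersCount A := by
    intro A hA
    funext ω
    unfold pointCount layersCount
    congr 1
    ext n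
    simp only [Set.mem_ofPred_eq, U, W]
    split_ifs with h
    · simp only [h, true_and]
      rcases le_total ((ω n.unpair.1).2 n.unpair.2).1 0 with h0 | h0
      · rw [max_eq_right h0]
        exact ⟨fun h' => (lt_irrefl (0 : ℝ) (hA h').1).elim, fun h' => (not_lt.2 h0 (hA h').1).elim⟩
      · rw [max_eq_left h0]
    · simp only [h, false_and, iff_false]
      exact fun h' => lt_irrefl (0 : ℝ) (hA h').1
  refine ⟨_, inferInstance, layersMeasure p m, U, W, inferInstance, ?_, ?_, ?_, ?_, ?_⟩
  · intro n
    refine Measurable.ite (measurableSet_lt measurable_const ?_) ?_ measurable_const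
    · exact measurable_fst.comp (measurable_pi_apply _)
    · fun_prop
  · intro n
    fun_prop
  · intro n ω
    simp only [U]
    split_ifs
    · exact le_max_right _ _
    · exact le_rfl
  · intro A hA hsub hfin k
    rw [hcount A hsub]
    exact map_layersCount_eq_poisson hμ hA hfin k
  · intro r A hA hsub hdisj
    have : (fun i => pointCount U W (A i)) = fun i => layersCount (A i) :=
      funext fun i => hcount _ (hsub i)
    rw [this]
    exact iIndepFun_layersCount hμ hA hdisj

/-! ### Tail correlation functions of max-stable processes -/

instance : SFinite frechetIntensity := by
  unfold frechetIntensity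
  infer_instance

theorem frechetIntensity_Ioi {a : ℝ} (ha : 0 < a) :
    frechetIntensity (Set.Ioi a) = ENNReal.ofReal a⁻¹ := by
  have hsub : Set.Ioi a ∩ Set.Ioi 0 = Set.Ioi a :=
    Set.inter_eq_left.2 (Set.Ioi_subset_Ioi ha.le)
  have hcongr : ∀ u ∈ Set.Ioi a, (u ^ 2)⁻¹ = u ^ (-2 : ℝ) := by
    intro u hu
    rw [Real.rpow_neg (ha.trans hu).le]
    norm_cast
  rw [frechetIntensity, withDensity_apply _ measurableSet_Ioi,
    Measure.restrict_restrict measurableSet_Ioi, hsub,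
    setLIntegral_congr_fun measurableSet_Ioi fun u hu => congrArg ENNReal.ofReal (hcongr u hu),
    ← ofReal_integral_eq_lintegral_ofReal (integrableOn_Ioi_rpow_of_lt (by norm_num) ha),
    integral_Ioi_rpow_of_lt (by norm_num) ha]
  · congr 1
    norm_num
    exact Real.rpow_neg_one a
  · filter_upwards [ae_restrict_mem measurableSet_Ioi] with u hu
    exact Real.rpow_nonneg (ha.trans hu).le _

theorem frechetIntensity_Ioi_zero : frechetIntensity (Set.Ioi 0) = ∞ := by
  refine ENNReal.eq_top_of_forall_nnreal_le fun r => ?_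
  have hr : (0 : ℝ) < r + 1 := by positivity
  calc (r : ℝ≥0∞) ≤ ENNReal.ofReal ((r + 1 : ℝ)⁻¹)⁻¹ := by
        rw [inv_inv, ENNReal.le_ofReal_iff_toReal_le ENNReal.coe_ne_top hr.le]
        simp
    _ = frechetIntensity (Set.Ioi (r + 1 : ℝ)⁻¹) := (frechetIntensity_Ioi (by positivity)).symm
    _ ≤ frechetIntensity (Set.Ioi 0) := measure_mono (Set.Ioi_subset_Ioi (by positivity))

/-- The set of points `(u, w)` with `u V(w) > τ`. -/
def exceedance {S : Type} (V : S → ℝ≥0∞) (τ : ℝ≥0) : Set (ℝ × S) :=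
  {q | 0 < q.1 ∧ (τ : ℝ≥0∞) < ENNReal.ofReal q.1 * V q.2}

theorem measurableSet_exceedance {S : Type} [MeasurableSpace S] {V : S → ℝ≥0∞} (hV : Measurable V)
    (τ : ℝ≥0) : MeasurableSet (exceedance V τ) :=
  (measurableSet_lt measurable_const measurable_fst).inter
    (measurableSet_lt measurable_const
      (measurable_fst.ennreal_ofReal.mul (hV.comp measurable_snd)))

theorem frechetIntensity_section {τ : ℝ≥0} (hτ : 0 < τ) (v : ℝ≥0∞) :
    frechetIntensity {u | 0 < u ∧ (τ : ℝ≥0∞) < ENNReal.ofReal u * v} = v / τ := by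
  rcases eq_or_ne v 0 with rfl | h0
  · simp
  rcases eq_or_ne v ∞ with rfl | htop
  · have : {u : ℝ | 0 < u ∧ (τ : ℝ≥0∞) < ENNReal.ofReal u * ∞} = Set.Ioi 0 := by
      ext u
      simp only [Set.mem_ofPred_eq, Set.mem_Ioi, and_iff_left_iff_imp]
      intro hu
      rw [ENNReal.mul_top (ENNReal.ofReal_pos.2 hu).ne']
      exact ENNReal.coe_lt_top
    rw [this, frechetIntensity_Ioi_zero, ENNReal.top_div_of_ne_top ENNReal.coe_ne_top]
  lift v to ℝ≥0 using htop
  have hv : 0 < v := pos_iff_ne_zero.2 (by simpa using h0)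
  have hpos : (0 : ℝ) < τ / v := div_pos hτ hv
  have : {u : ℝ | 0 < u ∧ (τ : ℝ≥0∞) < ENNReal.ofReal u * v} = Set.Ioi (τ / v : ℝ) := by
    ext u
    have hiff : 0 < u → ((τ : ℝ≥0∞) < ENNReal.ofReal u * v ↔ (τ / v : ℝ) < u) := by
      intro hu
      lift u to ℝ≥0 using hu.le
      rw [ENNReal.ofReal_coe_nnreal, div_lt_iff₀ (by exact_mod_cast hv)]
      exact_mod_cast Iff.rfl
    exact ⟨fun h => (hiff h.1).1 h.2, fun h => ⟨hpos.trans h, (hiff (hpos.trans h)).2 h⟩⟩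
  rw [this, frechetIntensity_Ioi hpos, inv_div, ENNReal.ofReal_div_of_pos (by exact_mod_cast hτ)]
  simp

theorem prod_exceedance {S : Type} [MeasurableSpace S] (ν : Measure S) [SFinite ν] {V : S → ℝ≥0∞}
    (hV : Measurable V) {τ : ℝ≥0} (hτ : 0 < τ) :
    frechetIntensity.prod ν (exceedance V τ) = (∫⁻ w, V w ∂ν) / τ := by
  rw [Measure.prod_apply_symm (measurableSet_exceedance hV τ)]
  have : ∀ w, frechetIntensity ((fun u => (u, w)) ⁻¹' exceedance V τ) = V w / τ := fun w =>
    frechetIntensity_section hτ (V w)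
  simp only [this, div_eq_mul_inv]
  rw [lintegral_mul_const _ hV]

/-- The supremum `sup_n U_n V(W_n)`. -/
def spectralSup {Ω S : Type} (U : ℕ → Ω → ℝ) (W : ℕ → Ω → S) (V : S → ℝ≥0∞) (ω : Ω) : ℝ≥0∞ :=
  ⨆ n, ENNReal.ofReal (U n ω) * V (W n ω)

theorem spectralSup_max {Ω S : Type} (U : ℕ → Ω → ℝ) (W : ℕ → Ω → S) (V V' : S → ℝ≥0∞) (ω : Ω) :
    spectralSup U W (fun w => max (V w) (V' w)) ω =
      max (spectralSup U W V ω) (spectralSup U W V' ω) := by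
  unfold spectralSup
  rw [← iSup_sup_eq]
  congr 1
  funext n
  exact mul_max _ _ _

/-! ### The Fréchet law of a spectral supremum. -/

section Poisson

variable {Ω S : Type} [MeasurableSpace Ω] [MeasurableSpace S] {P : Measure Ω} {ν : Measure S}
  {U : ℕ → Ω → ℝ} {W : ℕ → Ω → S}

theorem IsPoissonPointProcess.measurable_spectralSup (h : IsPoissonPointProcess P ν U W)
    {V : S → ℝ≥0∞} (hV : Measurable V) : Measurable (spectralSup U W V) :=
  Measurable.iSup fun n => (h.measurable_fst n).ennreal_ofReal.mul (hV.comp (h.measurable_snd n))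

/-- The supremum is at most `τ` exactly when the exceedance set contains no point: a Poisson
variable with mean `∫ V dν / τ` vanishes. -/
theorem IsPoissonPointProcess.measure_spectralSup_le [SFinite ν] (h : IsPoissonPointProcess P ν U W)
    {V : S → ℝ≥0∞} (hV : Measurable V) (hfin : ∫⁻ w, V w ∂ν ≠ ∞) {τ : ℝ≥0} (hτ : 0 < τ) :
    P.real {ω | spectralSup U W V ω ≤ τ} = Real.exp (-((∫⁻ w, V w ∂ν).toReal / τ)) := by
  have hset : {ω | spectralSup U W V ω ≤ τ} =
      {ω | pointCount U W (exceedance V τ) ω = (0 : ℕ)} := by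
    ext ω
    simp only [Set.mem_ofPred_eq, spectralSup, iSup_le_iff, pointCount, Nat.cast_zero,
      Set.encard_eq_zero, Set.eq_empty_iff_forall_notMem, exceedance, not_and, not_lt]
    refine forall_congr' fun n => ⟨fun hn _ => hn, fun hn => ?_⟩
    -- An index with `U n ω = 0` contributes `0` to the supremum, even where `V = ∞`.
    rcases (h.nonneg n ω).eq_or_lt with h0 | h0
    · simp [← h0]
    · exact hn h0
  have hne : (∫⁻ w, V w ∂ν) / (τ : ℝ≥0∞) ≠ ∞ :=
    ENNReal.div_ne_top hfin (by exact_mod_cast hτ.ne')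
  rw [hset, Measure.real, h.poisson _ (measurableSet_exceedance hV τ) (fun q hq => ⟨hq.1, trivial⟩)
    (by rwa [prod_exceedance ν hV hτ]), prod_exceedance ν hV hτ, poissonMeasure_singleton,
    ENNReal.toReal_ofReal (by positivity)]
  have : (((∫⁻ w, V w ∂ν) / (τ : ℝ≥0∞)).toNNReal : ℝ) = (∫⁻ w, V w ∂ν).toReal / τ := by
    rw [ENNReal.coe_toNNReal_eq_toReal, ENNReal.toReal_div]
    rfl
  rw [this]
  simp

/-- The law has no atom at `τ`, because `exp(-c/σ)` is continuous at `σ = τ`. The strict version is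
needed because the TCF is defined through `≥ τ`. -/
theorem IsPoissonPointProcess.measure_spectralSup_lt [IsProbabilityMeasure P] [SFinite ν]
    (h : IsPoissonPointProcess P ν U W)
    {V : S → ℝ≥0∞} (hV : Measurable V) (hfin : ∫⁻ w, V w ∂ν ≠ ∞) {τ : ℝ≥0} (hτ : 0 < τ) :
    P.real {ω | spectralSup U W V ω < τ} = Real.exp (-((∫⁻ w, V w ∂ν).toReal / τ)) := by
  refine le_antisymm ?_ ?_
  · rw [← h.measure_spectralSup_le hV hfin hτ]
    exact measureReal_mono (Set.ofPred_subset_ofPred.2 fun ω hω => hω.le)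
  · have hlim : Tendsto (fun σ : ℝ≥0 => Real.exp (-((∫⁻ w, V w ∂ν).toReal / σ))) (𝓝[<] τ)
        (𝓝 (Real.exp (-((∫⁻ w, V w ∂ν).toReal / τ)))) := by
      refine tendsto_nhdsWithin_of_tendsto_nhds ?_
      refine (Real.continuous_exp.tendsto _).comp (Tendsto.neg (Tendsto.div tendsto_const_nhds
        (NNReal.continuous_coe.tendsto τ) ?_))
      exact_mod_cast hτ.ne'
    have : (𝓝[<] τ).NeBot := nhdsLT_neBot_of_exists_lt ⟨0, hτ⟩
    refine le_of_tendsto hlim ?_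
    filter_upwards [Ioo_mem_nhdsLT hτ] with σ hσ
    rw [← h.measure_spectralSup_le hV hfin hσ.1]
    exact measureReal_mono fun ω (hω : _ ≤ _) => hω.trans_lt (ENNReal.coe_lt_coe.2 hσ.2)

theorem IsPoissonPointProcess.spectralSup_ne_top [IsProbabilityMeasure P] [SFinite ν]
    (h : IsPoissonPointProcess P ν U W)
    {V : S → ℝ≥0∞} (hV : Measurable V) (hfin : ∫⁻ w, V w ∂ν ≠ ∞) :
    ∀ᵐ ω ∂P, spectralSup U W V ω ≠ ∞ := by
  have hm := h.measurable_spectralSup hV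
  have hbound : ∀ᶠ τ : ℝ≥0 in atTop, P.real {ω | ¬ spectralSup U W V ω ≠ ∞} ≤
      1 - Real.exp (-((∫⁻ w, V w ∂ν).toReal / τ)) := by
    filter_upwards [eventually_gt_atTop 0] with τ hτ
    rw [← h.measure_spectralSup_le hV hfin hτ,
      ← probReal_compl_eq_one_sub (measurableSet_le hm measurable_const)]
    refine measureReal_mono fun ω hω => ?_
    simp only [ne_eq, not_not, Set.mem_ofPred_eq] at hω
    simp [hω]
  have hlim : Tendsto (fun τ : ℝ≥0 => 1 - Real.exp (-((∫⁻ w, V w ∂ν).toReal / τ))) atTop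
      (𝓝 (1 - Real.exp (-0))) := by
    refine Tendsto.const_sub _ ((Real.continuous_exp.tendsto _).comp (Tendsto.neg ?_))
    exact Tendsto.div_atTop tendsto_const_nhds (NNReal.tendsto_coe_atTop.2 tendsto_id)
  have hle := ge_of_tendsto hlim hbound
  rw [neg_zero, Real.exp_zero, sub_self] at hle
  rw [ae_iff, ← measureReal_eq_zero_iff]
  exact le_antisymm hle measureReal_nonneg

end Poisson

/-- With `x = 1/τ → 0` the second factor is `2(1 - e^{-x}) - (1 - e^{-Mx})`, and `1 - e^{-cx}` has
slope `c` at `0`. -/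
theorem tendsto_tail_ratio (M : ℝ) :
    Tendsto (fun τ : ℝ≥0 => (1 - Real.exp (-(1 / τ)))⁻¹ *
      (1 - 2 * Real.exp (-(1 / τ)) + Real.exp (-(M / τ)))) atTop (𝓝 (2 - M)) := by
  have hder : ∀ c : ℝ, Tendsto (fun x : ℝ => x⁻¹ * (1 - Real.exp (-(c * x)))) (𝓝[>] 0) (𝓝 c) := by
    intro c
    have h1 : HasDerivAt (fun x : ℝ => 1 - Real.exp (-(c * x))) c 0 := by
      have h2 := (((hasDerivAt_id (0 : ℝ)).const_mul c).fun_neg.exp).const_sub 1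
      simpa using h2
    have h3 := (hasDerivAt_iff_tendsto_slope.1 h1).mono_left
      (nhdsWithin_mono 0 (fun x (hx : 0 < x) => hx.ne'))
    refine h3.congr fun x => ?_
    simp [slope_def_field, div_eq_inv_mul]
  have hx : Tendsto (fun τ : ℝ≥0 => 1 / (τ : ℝ)) atTop (𝓝[>] 0) := by
    have := tendsto_inv_atTop_nhdsGT_zero.comp (NNReal.tendsto_coe_atTop.2 (tendsto_id (α := ℝ≥0)))
    simpa [Function.comp_def] using this
  have h1 := (hder 1).comp hx
  have h2 := (hder M).comp hx
  have h3 := (h1.inv₀ one_ne_zero).mul ((h1.const_mul 2).sub h2)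
  simp only [inv_one, one_mul, mul_one] at h3
  refine h3.congr' ?_
  filter_upwards [eventually_gt_atTop 0] with τ hτ
  have hτ' : (0 : ℝ) < τ := by exact_mod_cast hτ
  simp only [Function.comp, one_div, inv_inv, mul_inv, ← div_eq_mul_inv]
  field_simp
  ring

/-! ### Tail correlations from spectral representations. -/

section Tail

variable {T Ω S : Type} [MeasurableSpace Ω] [MeasurableSpace S] {P : Measure Ω} {X : T → Ω → ℝ≥0}
  {ν : Measure S} [SFinite ν] {V : T → S → ℝ≥0∞}

/-- By inclusion–exclusion the joint exceedance probability involves only `M = ∫ max(V_o, V_t)`, and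
`max + min` being the sum of the two functions gives `2 - M = ∫ min(V_o, V_t)`. -/
theorem HasSpectralRep.tendsto_cond (h : HasSpectralRep P X ν V) (hV : ∀ t, Measurable (V t))
    (h1 : ∀ t, ∫⁻ w, V t w ∂ν = 1) (o t : T) :
    Tendsto (fun τ : ℝ≥0 => (P[|{ω | τ ≤ X o ω}]).real {ω | τ ≤ X t ω}) atTop
      (𝓝 (∫⁻ w, min (V o w) (V t w) ∂ν).toReal) := by
  obtain ⟨Ω', _, P', U, W, _, hU, hid⟩ := h
  set M := ∫⁻ w, max (V o w) (V t w) ∂ν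
  have hsum : M + ∫⁻ w, min (V o w) (V t w) ∂ν = 2 := by
    rw [← lintegral_add_left ((hV o).max (hV t))]
    simp only [max_add_min]
    rw [lintegral_add_left (hV o), h1, h1]
    norm_num
  have hMtop : M ≠ ∞ := fun hM => by simp [hM] at hsum
  have hmtop : ∫⁻ w, min (V o w) (V t w) ∂ν ≠ ∞ := fun hM => by simp [hM] at hsum
  have hval : (∫⁻ w, min (V o w) (V t w) ∂ν).toReal = 2 - M.toReal := by
    have := congrArg ENNReal.toReal hsum
    rw [ENNReal.toReal_add hMtop hmtop] at this
    norm_num at this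
    linarith
  rw [hval]
  refine (tendsto_tail_ratio M.toReal).congr' ?_
  filter_upwards [eventually_gt_atTop 0] with τ hτ
  have hmeas : ∀ s, MeasurableSet {x : T → ℝ≥0∞ | (τ : ℝ≥0∞) ≤ x s} := fun s =>
    measurableSet_le measurable_const (measurable_pi_apply s)
  have hset : ∀ s, {ω | τ ≤ X s ω} =
      (fun ω s => (X s ω : ℝ≥0∞)) ⁻¹' {x : T → ℝ≥0∞ | (τ : ℝ≥0∞) ≤ x s} := by
    intro s
    ext ω
    simp
  -- Equality in distribution only makes `X` almost everywhere measurable.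
  have hnull : ∀ s, NullMeasurableSet {ω | τ ≤ X s ω} P := fun s => by
    rw [hset]
    exact hid.aemeasurable_fst.nullMeasurable (hmeas s)
  have hcompl : ∀ s, {ω | (τ : ℝ≥0∞) ≤ spectralSup U W (V s) ω} =
      {ω | spectralSup U W (V s) ω < τ}ᶜ := fun s => by
    ext ω
    simp
  have hmlt : ∀ s, MeasurableSet {ω | spectralSup U W (V s) ω < τ} := fun s =>
    measurableSet_lt (hU.measurable_spectralSup (hV s)) measurable_const
  have hlt : ∀ s, P'.real {ω | spectralSup U W (V s) ω < τ} = Real.exp (-(1 / τ)) := fun s => by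
    rw [hU.measure_spectralSup_lt (hV s) (by simp [h1]) hτ, h1]
    simp
  have hlt2 : P'.real ({ω | spectralSup U W (V o) ω < τ} ∩ {ω | spectralSup U W (V t) ω < τ}) =
      Real.exp (-(M.toReal / τ)) := by
    rw [← hU.measure_spectralSup_lt ((hV o).max (hV t)) hMtop hτ]
    congr 1
    ext ω
    simp [spectralSup_max]
  have hP1 : P.real {ω | τ ≤ X o ω} = 1 - Real.exp (-(1 / τ)) := by
    rw [hset, Measure.real, hid.measure_mem_eq (hmeas o)]
    change P'.real {ω | (τ : ℝ≥0∞) ≤ spectralSup U W (V o) ω} = _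
    rw [hcompl, probReal_compl_eq_one_sub (hmlt o), hlt]
  have hP2 : P.real ({ω | τ ≤ X o ω} ∩ {ω | τ ≤ X t ω}) =
      1 - 2 * Real.exp (-(1 / τ)) + Real.exp (-(M.toReal / τ)) := by
    rw [hset o, hset t, ← Set.preimage_inter, Measure.real,
      hid.measure_mem_eq ((hmeas o).inter (hmeas t))]
    change P'.real ({ω | (τ : ℝ≥0∞) ≤ spectralSup U W (V o) ω} ∩
      {ω | (τ : ℝ≥0∞) ≤ spectralSup U W (V t) ω}) = _
    rw [hcompl, hcompl, ← Set.compl_union, probReal_compl_eq_one_sub ((hmlt o).union (hmlt t))]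
    have := measureReal_union_add_inter (μ := P') (s := {ω | spectralSup U W (V o) ω < τ}) (hmlt t)
    rw [hlt, hlt, hlt2] at this
    linarith
  rw [← hP1, ← hP2, ProbabilityTheory.cond, Measure.real, Measure.real, Measure.real,
    Measure.smul_apply,
    Measure.restrict_apply₀' (hnull o), smul_eq_mul, ENNReal.toReal_mul, ENNReal.toReal_inv,
    Set.inter_comm]

theorem exists_hasSpectralRep [Nonempty S] (hV : ∀ t, Measurable (V t))
    (h1 : ∀ t, ∫⁻ w, V t w ∂ν = 1) :
    ∃ (Ω : Type) (_ : MeasurableSpace Ω) (P : Measure Ω) (X : T → Ω → ℝ≥0),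
      IsProbabilityMeasure P ∧ HasSpectralRep P X ν V := by
  obtain ⟨Ω, mΩ, P, U, W, hP, hU⟩ := exists_isPoissonPointProcess ν
  have hm : ∀ t, Measurable (spectralSup U W (V t)) := fun t => hU.measurable_spectralSup (hV t)
  refine ⟨Ω, mΩ, P, fun t ω => (spectralSup U W (V t) ω).toNNReal, hP, Ω, mΩ, P, U, W, hP, hU, ?_⟩
  have hmX : Measurable fun ω t => (((spectralSup U W (V t) ω).toNNReal : ℝ≥0) : ℝ≥0∞) :=
    measurable_pi_lambda _ fun t => (hm t).ennreal_toNNReal.coe_nnreal_ennreal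
  have hmZ : Measurable fun ω t => spectralSup U W (V t) ω := measurable_pi_lambda _ hm
  refine ⟨hmX.aemeasurable, hmZ.aemeasurable, ?_⟩
  -- Almost sure equality at each fixed `t` suffices for equality of the finite-dimensional laws,
  -- even if `T` is uncountable.
  refine map_eq_of_forall_ae_eq
    (X := fun t ω => (((spectralSup U W (V t) ω).toNNReal : ℝ≥0) : ℝ≥0∞))
    (Y := fun t ω => spectralSup U W (V t) ω) hmX.aemeasurable hmZ.aemeasurable fun t => ?_
  filter_upwards [hU.spectralSup_ne_top (hV t) (by simp [h1])] with ω hω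
  exact ENNReal.coe_toNNReal hω

end Tail

/-- The tail correlation `∫∫ min(f_a(-z), f_a(t - z)) dz dQ(a)` of a random shape. -/
def shapeOverlap {F : Type} [MeasurableSpace F] (d : ℕ) (Q : Measure F) (f : F → E d → ℝ≥0∞)
    (t : E d) : ℝ≥0∞ :=
  ∫⁻ a, (∫⁻ z : E d, min (f a (-z)) (f a (t - z))) ∂Q

/-- A random shape has exactly one tail correlation function. -/
theorem isM3TCF_iff {F : Type} [MeasurableSpace F] {d : ℕ} {Q : Measure F} {f : F → E d → ℝ≥0∞}
    {χ : E d → ℝ} : IsM3TCF d Q f χ ↔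
      IsRandomShape d Q f ∧ χ = fun t => (shapeOverlap d Q f t).toReal := by
  have key : IsRandomShape d Q f → IsProbabilityMeasure Q ∧
      (∀ t, Measurable fun p : E d × F => f p.2 (t - p.1)) ∧
      (∀ t, ∫⁻ p, f p.2 (t - p.1) ∂((volume : Measure (E d)).prod Q) = 1) ∧
      ∀ t, shapeOverlap d Q f t =
        ∫⁻ p, min (f p.2 (0 - p.1)) (f p.2 (t - p.1)) ∂((volume : Measure (E d)).prod Q) := by
    intro hf
    have := hf.isProb
    have hm : ∀ t, Measurable fun p : E d × F => f p.2 (t - p.1) := fun t =>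
      hf.measurable.comp (measurable_snd.prodMk (measurable_const.sub measurable_fst))
    refine ⟨this, hm, fun t => ?_, fun t => ?_⟩
    · rw [lintegral_prod_symm' _ (hm t)]
      rw [← hf.integral_eq_one]
      exact lintegral_congr fun a => lintegral_sub_left_eq_self (f a) t
    · rw [lintegral_prod_symm' _ ((hm 0).min (hm t))]
      simp [shapeOverlap]
  constructor
  · rintro ⟨Ω, _, P, X, _, ⟨hf, hX⟩, hχ⟩
    obtain ⟨_, hm, h1, h2⟩ := key hf
    refine ⟨hf, funext fun t => ?_⟩
    rw [h2]
    exact tendsto_nhds_unique (hχ t) (hX.tendsto_cond hm h1 0 t)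
  · rintro ⟨hf, rfl⟩
    obtain ⟨_, hm, h1, h2⟩ := key hf
    have : Nonempty F := nonempty_of_isProbabilityMeasure Q
    obtain ⟨Ω, mΩ, P, X, hP, hX⟩ := exists_hasSpectralRep hm h1
    refine ⟨Ω, mΩ, P, X, hP, ⟨hf, hX⟩, fun t => ?_⟩
    simp only [h2]
    exact hX.tendsto_cond hm h1 0 t

/-! ### The volume of the intersection of two balls -/

theorem volume_closedBall_eq (d : ℕ) (x : E d) {r : ℝ} (hr : 0 ≤ r) :
    volume (Metric.closedBall x r) = ENNReal.ofReal (r ^ d) * kappa d := by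
  rw [Measure.addHaar_closedBall' volume x hr, finrank_euclideanSpace_fin, kappa]

theorem kappa_pos (d : ℕ) : 0 < kappa d := Metric.measure_closedBall_pos volume _ one_pos

theorem kappa_ne_top (d : ℕ) : kappa d ≠ ∞ := measure_closedBall_lt_top.ne

/-- Dimension `0` is included because the sections of a one-dimensional ball live there. -/
theorem kappa_eq (d : ℕ) :
    kappa d = ENNReal.ofReal (√Real.pi ^ d / Real.Gamma (d / 2 + 1)) := by
  rcases d with - | d
  · have h : (Metric.closedBall (0 : E 0) 1) = (WithLp.ofLp : E 0 → Fin 0 → ℝ) ⁻¹' Set.univ := by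
      ext x
      simp [Subsingleton.elim x 0]
    rw [kappa, h, (PiLp.volume_preserving_ofLp (Fin 0)).measure_preimage
      MeasurableSet.univ.nullMeasurableSet, volume_pi, Measure.pi_of_empty]
    simp
  · rw [kappa, EuclideanSpace.volume_closedBall]
    simp

/-- The first coordinate and the remaining coordinates of a vector. -/
def splitFirst (n : ℕ) (z : E (n + 1)) : ℝ × E n := (z 0, WithLp.toLp 2 fun j => z j.succ)

theorem measurePreserving_splitFirst (n : ℕ) :
    MeasurePreserving (splitFirst n) volume (volume.prod volume) :=
  ((MeasurePreserving.id volume).prod (PiLp.volume_preserving_toLp (Fin n))).comp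
    ((volume_preserving_piFinSuccAbove (fun _ : Fin (n + 1) => ℝ) 0).comp
      (PiLp.volume_preserving_ofLp (Fin (n + 1))))

theorem norm_sq_eq_splitFirst (n : ℕ) (z : E (n + 1)) :
    ‖z‖ ^ 2 = (splitFirst n z).1 ^ 2 + ‖(splitFirst n z).2‖ ^ 2 := by
  simp [splitFirst, EuclideanSpace.norm_sq_eq, Fin.sum_univ_succ]

/-- Cavalieri's principle: the slice at first coordinate `v` is an `n`-dimensional ball of radius
`√(1 - v²)`. -/
theorem volume_ball_section (n : ℕ) {I : Set ℝ} (hI : MeasurableSet I) (hpos : I ⊆ Set.Ici 0) :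
    volume {z : E (n + 1) | ‖z‖ ≤ 1 ∧ z 0 ∈ I} =
      (∫⁻ v in I ∩ Set.Iic 1, ENNReal.ofReal ((1 - v ^ 2) ^ ((n : ℝ) / 2))) * kappa n := by
  set A : Set (ℝ × E n) := {q | q.1 ^ 2 + ‖q.2‖ ^ 2 ≤ 1 ∧ q.1 ∈ I}
  have hA : MeasurableSet A :=
    (measurableSet_le (f := fun q : ℝ × E n => q.1 ^ 2 + ‖q.2‖ ^ 2) (by fun_prop)
      measurable_const).inter (measurable_fst hI)
  have hpre : {z : E (n + 1) | ‖z‖ ≤ 1 ∧ z 0 ∈ I} = splitFirst n ⁻¹' A := by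
    ext z
    simp only [A, Set.mem_ofPred_eq, Set.mem_preimage]
    rw [← norm_sq_eq_splitFirst, sq_le_one_iff₀ (norm_nonneg z)]
    rfl
  rw [hpre, (measurePreserving_splitFirst n).measure_preimage hA.nullMeasurableSet,
    Measure.prod_apply hA, ← lintegral_mul_const' _ _ (kappa_ne_top n),
    ← lintegral_indicator (hI.inter measurableSet_Iic)]
  refine lintegral_congr fun v => ?_
  by_cases hv : v ∈ I ∩ Set.Iic 1
  · have h0 : 0 ≤ v := hpos hv.1
    have h1 : 0 ≤ 1 - v ^ 2 := by nlinarith [hv.2.out]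
    have hsec : Prod.mk v ⁻¹' A = Metric.closedBall (0 : E n) (√(1 - v ^ 2)) := by
      ext w
      simp only [A, Set.mem_preimage, Set.mem_ofPred_eq, hv.1, and_true, mem_closedBall_zero_iff]
      rw [Real.le_sqrt (norm_nonneg w) h1]
      constructor <;> intro h <;> linarith
    rw [hsec, Set.indicator_of_mem hv, volume_closedBall_eq n 0 (Real.sqrt_nonneg _)]
    congr 2
    rw [Real.sqrt_eq_rpow, ← Real.rpow_natCast, ← Real.rpow_mul h1]
    congr 1
    ring
  · rw [Set.indicator_of_notMem hv]
    have hsec : Prod.mk v ⁻¹' A = ∅ := by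
      ext w
      simp only [A, Set.mem_preimage, Set.mem_ofPred_eq, Set.mem_empty_iff_false, iff_false]
      rintro ⟨h1, h2⟩
      refine hv ⟨h2, ?_⟩
      have h0 : 0 ≤ v := hpos h2
      simp only [Set.mem_Iic]
      nlinarith [sq_nonneg ‖w‖]
    rw [hsec, measure_empty]

theorem continuous_hFun_density (n : ℕ) : Continuous fun v : ℝ => (1 - v ^ 2) ^ ((n : ℝ) / 2) :=
  Continuous.rpow_const (by fun_prop) fun _ => Or.inr (by positivity)

theorem integral_hFun_density_nonneg (n : ℕ) {s : ℝ} (hs : 0 ≤ s) :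
    0 ≤ ∫ v in Set.Icc s 1, (1 - v ^ 2) ^ ((n : ℝ) / 2) := by
  refine setIntegral_nonneg measurableSet_Icc fun v hv => Real.rpow_nonneg ?_ _
  nlinarith [hv.1, hv.2]

theorem lintegral_hFun_density (n : ℕ) {s : ℝ} (hs : 0 ≤ s) :
    ∫⁻ v in Set.Icc s 1, ENNReal.ofReal ((1 - v ^ 2) ^ ((n : ℝ) / 2)) =
      ENNReal.ofReal (∫ v in Set.Icc s 1, (1 - v ^ 2) ^ ((n : ℝ) / 2)) := by
  rw [ofReal_integral_eq_lintegral_ofReal]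
  · exact (continuous_hFun_density n).continuousOn.integrableOn_compact isCompact_Icc
  · filter_upwards [ae_restrict_mem measurableSet_Icc] with v hv
    refine Real.rpow_nonneg ?_ _
    nlinarith [hv.1, hv.2]

theorem volume_cap (n : ℕ) {s : ℝ} (hs : 0 ≤ s) {I : Set ℝ} (hI : I = Set.Ici s ∨ I = Set.Ioi s) :
    volume {z : E (n + 1) | ‖z‖ ≤ 1 ∧ z 0 ∈ I} =
      ENNReal.ofReal (∫ v in Set.Icc s 1, (1 - v ^ 2) ^ ((n : ℝ) / 2)) * kappa n := by
  rw [← lintegral_hFun_density n hs]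
  rcases hI with rfl | rfl
  · rw [volume_ball_section n measurableSet_Ici (Set.Ici_subset_Ici.2 hs), Set.Ici_inter_Iic]
  · rw [volume_ball_section n measurableSet_Ioi (Set.Ioi_subset_Ici hs), Set.Ioi_inter_Iic,
      ← setLIntegral_congr Ioc_ae_eq_Icc]

/-- The normalizing constant of `h_d` is `2 κ_{d-1} / κ_d`, so that `κ_d h_d` measures two caps of
the unit ball. -/
theorem hFun_coeff (n : ℕ) :
    ((n + 1 : ℕ) : ℝ) * Real.Gamma ((n + 1 : ℕ) / 2) /
      (√Real.pi * Real.Gamma (((n + 1 : ℕ) + 1) / 2)) * (kappa (n + 1)).toReal =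
      2 * (kappa n).toReal := by
  have hpi : 0 < √Real.pi := Real.sqrt_pos.2 Real.pi_pos
  have hG1 : 0 < Real.Gamma ((n : ℝ) / 2 + 1) := Real.Gamma_pos_of_pos (by positivity)
  have hG2 : 0 < Real.Gamma (((n + 1 : ℕ) : ℝ) / 2) := Real.Gamma_pos_of_pos (by positivity)
  have hG3 : Real.Gamma (((n + 1 : ℕ) : ℝ) / 2 + 1) =
      ((n + 1 : ℕ) : ℝ) / 2 * Real.Gamma (((n + 1 : ℕ) : ℝ) / 2) :=
    Real.Gamma_add_one (by positivity)
  have harg : (((n + 1 : ℕ) : ℝ) + 1) / 2 = (n : ℝ) / 2 + 1 := by push_cast; ring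
  rw [kappa_eq, kappa_eq, ENNReal.toReal_ofReal (by positivity), harg, hG3,
    ENNReal.toReal_ofReal (by positivity)]
  field_simp
  ring

theorem hFun_nonneg {d : ℕ} (hd : 1 ≤ d) {t : ℝ} (ht : 0 ≤ t) : 0 ≤ hFun d t := by
  obtain ⟨n, rfl⟩ := Nat.exists_eq_add_of_le' hd
  unfold hFun
  have hexp : (((n + 1 : ℕ) : ℝ) - 1) / 2 = (n : ℝ) / 2 := by push_cast; ring
  rw [hexp]
  exact mul_nonneg (div_nonneg (mul_nonneg (by positivity) (Real.Gamma_nonneg_of_nonneg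
    (by positivity))) (mul_nonneg (by positivity) (Real.Gamma_nonneg_of_nonneg (by positivity))))
    (integral_hFun_density_nonneg n ht)

/-- Twice the volume of a cap of the unit ball. -/
theorem kappa_mul_hFun (n : ℕ) {s : ℝ} (hs : 0 ≤ s) :
    kappa (n + 1) * ENNReal.ofReal (hFun (n + 1) s) =
      2 * (ENNReal.ofReal (∫ v in Set.Icc s 1, (1 - v ^ 2) ^ ((n : ℝ) / 2)) * kappa n) := by
  have hexp : (((n + 1 : ℕ) : ℝ) - 1) / 2 = (n : ℝ) / 2 := by push_cast; ring
  have hI := integral_hFun_density_nonneg n hs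
  rw [← ENNReal.toReal_eq_toReal_iff'
    (ENNReal.mul_ne_top (kappa_ne_top _) ENNReal.ofReal_ne_top)
    (ENNReal.mul_ne_top (by norm_num) (ENNReal.mul_ne_top ENNReal.ofReal_ne_top (kappa_ne_top _))),
    ENNReal.toReal_mul, ENNReal.toReal_ofReal (hFun_nonneg (by omega) hs), ENNReal.toReal_mul,
    ENNReal.toReal_mul, ENNReal.toReal_ofReal hI, ENNReal.toReal_ofNat, hFun, hexp]
  linear_combination (∫ v in Set.Icc s 1, (1 - v ^ 2) ^ ((n : ℝ) / 2)) * hFun_coeff n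

/-- The hyperplane `z 0 = t/2` bisects the lens. Beyond it points are closer to `e` than to `0`, so
that part of the lens is a cap of the ball around `0`; the point reflection `z ↦ e - z` swaps the
balls and carries the other half onto a cap of the same volume. -/
theorem volume_unit_lens_first (n : ℕ) {t : ℝ} (ht : 0 ≤ t) :
    volume (Metric.closedBall (0 : E (n + 1)) 1 ∩
      Metric.closedBall (EuclideanSpace.single 0 t) 1) =
      kappa (n + 1) * ENNReal.ofReal (hFun (n + 1) (t / 2)) := by
  set e : E (n + 1) := EuclideanSpace.single 0 t
  set L := Metric.closedBall (0 : E (n + 1)) 1 ∩ Metric.closedBall e 1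
  have he0 : e 0 = t := by simp [e]
  have hcoord : Measurable fun z : E (n + 1) => z 0 := by fun_prop
  have hsq : ∀ z : E (n + 1), ‖z - e‖ ^ 2 = ‖z‖ ^ 2 - 2 * (t * z 0) + t ^ 2 := by
    intro z
    rw [norm_sub_sq_real, EuclideanSpace.inner_single_right]
    simp [e]
  have hmem : ∀ z : E (n + 1), z ∈ L ↔ ‖z‖ ≤ 1 ∧ ‖z - e‖ ≤ 1 := by
    intro z
    simp [L, dist_eq_norm]
  have hle : ∀ z : E (n + 1), t / 2 ≤ z 0 → ‖z - e‖ ≤ ‖z‖ := by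
    intro z hz
    refine (sq_le_sq₀ (norm_nonneg _) (norm_nonneg _)).1 ?_
    rw [hsq]
    nlinarith
  have hupper : L ∩ {z | z 0 ∈ Set.Ioi (t / 2)} = {z | ‖z‖ ≤ 1 ∧ z 0 ∈ Set.Ioi (t / 2)} := by
    ext z
    simp only [Set.mem_inter_iff, hmem, Set.mem_ofPred_eq]
    exact ⟨fun h => ⟨h.1.1, h.2⟩, fun h => ⟨⟨h.1, (hle z (le_of_lt h.2)).trans h.1⟩, h.2⟩⟩
  have hlower : (fun z => e - z) ⁻¹' (L \ {z | z 0 ∈ Set.Ioi (t / 2)}) =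
      {z | ‖z‖ ≤ 1 ∧ z 0 ∈ Set.Ici (t / 2)} := by
    ext z
    have h1 : (e - z) 0 = t - z 0 := by simp [he0]
    simp only [Set.mem_preimage, Set.mem_sdiff, hmem, Set.mem_ofPred_eq, Set.mem_Ioi, Set.mem_Ici,
      h1, not_lt, sub_sub_cancel_left, norm_neg, norm_sub_rev e z]
    constructor
    · rintro ⟨⟨_, h⟩, h'⟩
      exact ⟨h, by linarith⟩
    · rintro ⟨h, h'⟩
      exact ⟨⟨(hle z h').trans h, h⟩, by linarith⟩
  have hmL : MeasurableSet L :=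
    Metric.isClosed_closedBall.measurableSet.inter Metric.isClosed_closedBall.measurableSet
  have hmI : MeasurableSet {z : E (n + 1) | z 0 ∈ Set.Ioi (t / 2)} := hcoord measurableSet_Ioi
  rw [kappa_mul_hFun n (by positivity), ← measure_inter_add_sdiff L hmI, hupper,
    volume_cap n (by positivity) (Or.inr rfl),
    ← (Measure.measurePreserving_sub_left volume e).measure_preimage
      (hmL.diff hmI).nullMeasurableSet,
    hlower, volume_cap n (by positivity) (Or.inl rfl), two_mul]

theorem volume_unit_lens {d : ℕ} (hd : 1 ≤ d) (x : E d) :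
    volume (Metric.closedBall (0 : E d) 1 ∩ Metric.closedBall x 1) =
      kappa d * ENNReal.ofReal (hFun d (‖x‖ / 2)) := by
  obtain ⟨n, rfl⟩ := Nat.exists_eq_add_of_le' hd
  rw [← volume_unit_lens_first n (norm_nonneg x)]
  have hnorm : ‖x‖ = ‖(EuclideanSpace.single 0 ‖x‖ : E (n + 1))‖ := by simp
  set e : E (n + 1) := EuclideanSpace.single 0 ‖x‖
  -- The reflection in the perpendicular bisector of `x` and `e`, two vectors of equal norm, fixes
  -- `0` and moves `x` onto the first axis.
  set ρ := (Submodule.span ℝ {x - e})ᗮ.reflection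
  have hρ : ρ x = e := Submodule.reflection_sub hnorm
  have hpre : Metric.closedBall (0 : E (n + 1)) 1 ∩ Metric.closedBall x 1 =
      ρ ⁻¹' (Metric.closedBall (0 : E (n + 1)) 1 ∩ Metric.closedBall e 1) := by
    rw [Set.preimage_inter, ← hρ, ρ.isometry.preimage_closedBall]
    conv_rhs => rw [← map_zero ρ, ρ.isometry.preimage_closedBall]
  rw [hpre, ρ.measurePreserving.measure_preimage
    (Metric.isClosed_closedBall.inter Metric.isClosed_closedBall).measurableSet.nullMeasurableSet]

theorem volume_lens {d : ℕ} (hd : 1 ≤ d) (x : E d) {r : ℝ} (hr : 0 < r) :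
    volume (Metric.closedBall (0 : E d) r ∩ Metric.closedBall x r) =
      volume (Metric.closedBall (0 : E d) r) * ENNReal.ofReal (hFun d (‖x‖ / (2 * r))) := by
  have hpre : Metric.closedBall (0 : E d) r ∩ Metric.closedBall x r =
      (fun z : E d => r⁻¹ • z) ⁻¹'
        (Metric.closedBall (0 : E d) 1 ∩ Metric.closedBall (r⁻¹ • x) 1) := by
    ext z
    simp only [Set.mem_inter_iff, Set.mem_preimage, Metric.mem_closedBall, dist_eq_norm, sub_zero,
      ← smul_sub, norm_smul, norm_inv, Real.norm_of_nonneg hr.le, inv_mul_le_iff₀ hr, mul_one]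
  rw [hpre, Measure.addHaar_preimage_smul volume (inv_ne_zero hr.ne'), volume_unit_lens hd,
    volume_closedBall_eq d 0 hr.le, finrank_euclideanSpace_fin, norm_smul, norm_inv,
    Real.norm_of_nonneg hr.le, inv_pow, inv_inv, abs_of_nonneg (by positivity), mul_assoc]
  congr 4
  field_simp

/-! ### Balls with a random radius and Gneiting's class -/

theorem hFun_antitoneOn {d : ℕ} (hd : 1 ≤ d) : AntitoneOn (hFun d) (Set.Ici 0) := by
  intro s hs t ht hst
  have hs' : (0 : ℝ) ≤ s := hs
  obtain ⟨n, rfl⟩ := Nat.exists_eq_add_of_le' hd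
  have hexp : (((n + 1 : ℕ) : ℝ) - 1) / 2 = (n : ℝ) / 2 := by push_cast; ring
  unfold hFun
  rw [hexp]
  refine mul_le_mul_of_nonneg_left ?_ (div_nonneg (mul_nonneg (by positivity)
    (Real.Gamma_nonneg_of_nonneg (by positivity))) (mul_nonneg (by positivity)
    (Real.Gamma_nonneg_of_nonneg (by positivity))))
  refine setIntegral_mono_set
    ((continuous_hFun_density n).continuousOn.integrableOn_compact isCompact_Icc) ?_
    (Set.Icc_subset_Icc_left hst).eventuallyLE
  filter_upwards [ae_restrict_mem measurableSet_Icc] with v hv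
  refine Real.rpow_nonneg ?_ _
  nlinarith [hv.1, hv.2]

theorem measurable_hFun_comp {d : ℕ} (hd : 1 ≤ d) {F : Type} [MeasurableSpace F] {s : F → ℝ}
    (hs : Measurable s) (h0 : ∀ a, 0 ≤ s a) : Measurable fun a => hFun d (s a) := by
  -- Monotonicity of `hFun` is available only on `[0,∞)`; truncating at `0` makes it global and
  -- yields measurability.
  have hanti : Antitone fun t : ℝ => hFun d (max t 0) := fun x y hxy =>
    hFun_antitoneOn hd (Set.mem_Ici.2 (le_max_right _ _)) (Set.mem_Ici.2 (le_max_right _ _))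
      (max_le_max_right 0 hxy)
  have := hanti.measurable.comp hs
  simpa [Function.comp_def, max_eq_left (h0 _)] using this

theorem uncurry_ballShape {F : Type} (d : ℕ) (R : F → ℝ) (q : F × E d) :
    Function.uncurry (fun a => ballShape d (R a)) q =
      {q : F × E d | ‖q.2‖ ≤ R q.1}.indicator
        (fun q => (ENNReal.ofReal (R q.1 ^ d) * kappa d)⁻¹) q := by
  by_cases h : ‖q.2‖ ≤ R q.1
  · have hq : q ∈ {q : F × E d | ‖q.2‖ ≤ R q.1} := h
    rw [Set.indicator_of_mem hq, Function.uncurry, ballShape,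
      Set.indicator_of_mem (mem_closedBall_zero_iff.2 h),
      volume_closedBall_eq d 0 ((norm_nonneg _).trans h)]
  · have hq : q ∉ {q : F × E d | ‖q.2‖ ≤ R q.1} := h
    rw [Set.indicator_of_notMem hq, Function.uncurry, ballShape,
      Set.indicator_of_notMem fun h' => h (mem_closedBall_zero_iff.1 h')]

section Radius

variable {F : Type} [MeasurableSpace F] {d : ℕ} {Q : Measure F} {R : F → ℝ}

theorem IsRandomRadius.isRandomShape (h : IsRandomRadius Q R) :
    IsRandomShape d Q fun a => ballShape d (R a) := by
  have := h.isProb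
  have hR := h.measurable
  refine ⟨h.isProb, ?_, ?_⟩
  · rw [show Function.uncurry (fun a => ballShape d (R a)) = _ from funext (uncurry_ballShape d R)]
    refine Measurable.indicator ?_ (measurableSet_le (by fun_prop) (by fun_prop))
    fun_prop
  · have : ∀ a, ∫⁻ x : E d, ballShape d (R a) x = 1 := by
      intro a
      rw [ballShape, lintegral_indicator Metric.isClosed_closedBall.measurableSet,
        setLIntegral_const, ENNReal.inv_mul_cancel
          (Metric.measure_closedBall_pos volume _ (h.pos a)).ne' measure_closedBall_lt_top.ne]
    simp [this]

theorem lintegral_min_ballShape (hd : 1 ≤ d) {r : ℝ} (hr : 0 < r) (t : E d) :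
    ∫⁻ z, min (ballShape d r (-z)) (ballShape d r (t - z)) =
      ENNReal.ofReal (hFun d (‖t‖ / (2 * r))) := by
  have hmin : ∀ z : E d, min (ballShape d r (-z)) (ballShape d r (t - z)) =
      (Metric.closedBall (0 : E d) r ∩ Metric.closedBall t r).indicator
        (fun _ => (volume (Metric.closedBall (0 : E d) r))⁻¹) z := by
    intro z
    have h0 : -z ∈ Metric.closedBall (0 : E d) r ↔ z ∈ Metric.closedBall (0 : E d) r := by simp
    have ht : t - z ∈ Metric.closedBall (0 : E d) r ↔ z ∈ Metric.closedBall t r := by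
      simp [dist_eq_norm, norm_sub_rev z t]
    by_cases h1 : z ∈ Metric.closedBall (0 : E d) r <;>
    by_cases h2 : z ∈ Metric.closedBall t r <;>
    rw [← h0] at h1 <;> rw [← ht] at h2 <;>
    simp only [ballShape, Set.indicator, Set.mem_inter_iff, ← h0, ← ht, h1, h2] <;> simp
  simp only [hmin]
  rw [lintegral_indicator (Metric.isClosed_closedBall.inter
    Metric.isClosed_closedBall).measurableSet, setLIntegral_const, volume_lens hd t hr, ← mul_assoc,
    ENNReal.inv_mul_cancel (Metric.measure_closedBall_pos volume _ hr).ne'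
      measure_closedBall_lt_top.ne, one_mul]

theorem IsRandomRadius.shapeOverlap_ballShape (h : IsRandomRadius Q R) (hd : 1 ≤ d) (t : E d) :
    shapeOverlap d Q (fun a => ballShape d (R a)) t =
      ∫⁻ a, ENNReal.ofReal (hFun d (‖t‖ / (2 * R a))) ∂Q :=
  lintegral_congr fun a => lintegral_min_ballShape hd (h.pos a) t

theorem IsRandomRadius.isM3bTCF_iff (h : IsRandomRadius Q R) (hd : 1 ≤ d) {χ : E d → ℝ} :
    IsM3bTCF d Q R χ ↔ χ = fun t => ∫ a, hFun d (‖t‖ / (2 * R a)) ∂Q := by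
  unfold IsM3bTCF
  rw [isM3TCF_iff, and_iff_right h.isRandomShape]
  have hpos : ∀ t : E d, ∀ a, 0 ≤ ‖t‖ / (2 * R a) := fun t a =>
    div_nonneg (norm_nonneg t) (mul_nonneg zero_le_two (h.pos a).le)
  have hR := h.measurable
  have : (fun t => (shapeOverlap d Q (fun a => ballShape d (R a)) t).toReal) =
      fun t => ∫ a, hFun d (‖t‖ / (2 * R a)) ∂Q := by
    funext t
    rw [h.shapeOverlap_ballShape hd, integral_eq_lintegral_of_nonneg_ae
      (Eventually.of_forall fun a => hFun_nonneg hd (hpos t a))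
      (measurable_hFun_comp hd (by fun_prop) (hpos t)).aestronglyMeasurable]
  rw [this]

end Radius

/-- A ball of radius `R` contributes `h_d(‖t‖/(2R))`, so `G` corresponds to the law of `1/(2R)`. -/
theorem tcfM3b_eq {d : ℕ} (hd : 1 ≤ d) : tcfM3b d = radial d '' gneitingClass d := by
  ext χ
  constructor
  · rintro ⟨F, _, Q, R, h, hχ⟩
    rw [h.isM3bTCF_iff hd] at hχ
    have := h.isProb
    have hR := h.measurable
    have hm : Measurable fun a => (2 * R a)⁻¹ := by fun_prop
    have hae : ∀ᵐ s ∂(Q.map fun a => (2 * R a)⁻¹), s ∈ Set.Ioi (0 : ℝ) := by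
      refine (ae_map_iff hm.aemeasurable (p := fun s => s ∈ Set.Ioi (0 : ℝ)) measurableSet_Ioi).2 ?_
      exact Eventually.of_forall fun a => inv_pos.2 (mul_pos two_pos (h.pos a))
    refine ⟨fun t => ∫ a, hFun d (t / (2 * R a)) ∂Q, ⟨Q.map fun a => (2 * R a)⁻¹,
      Measure.isProbabilityMeasure_map hm.aemeasurable, ?_, fun t => ?_⟩, ?_⟩
    · have := ae_iff.1 hae
      simpa [Set.Iic] using this
    · rw [Measure.restrict_eq_self_of_ae_mem hae]
      have hmeas : AEStronglyMeasurable (fun s => hFun d (s * t)) (Q.map fun a => (2 * R a)⁻¹) := by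
        have h1 : Measurable fun s : ℝ => hFun d (max s 0 * t) :=
          measurable_hFun_comp hd (by fun_prop) fun s => by positivity
        refine h1.aestronglyMeasurable.congr ?_
        filter_upwards [hae] with s hs
        rw [max_eq_left (le_of_lt hs)]
      rw [integral_map hm.aemeasurable hmeas]
      simp only [div_eq_inv_mul]
    · rw [hχ]
      rfl
  · rintro ⟨φ, ⟨G, _, hG0, hφ⟩, rfl⟩
    have hae : ∀ᵐ s ∂G, s ∈ Set.Ioi (0 : ℝ) := by
      rw [ae_iff]
      simpa [Set.Iic] using hG0
    -- The value `1` is used only on the `G`-null set `s ≤ 0`, to keep the radius positive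
    -- everywhere.
    let R : ℝ → ℝ := fun s => if 0 < s then (2 * s)⁻¹ else 1
    have h : IsRandomRadius G R := by
      refine ⟨inferInstance, Measurable.ite measurableSet_Ioi (by fun_prop) measurable_const,
        fun s => ?_⟩
      simp only [R]
      split_ifs <;> positivity
    refine ⟨ℝ, inferInstance, G, R, h, (h.isM3bTCF_iff hd).2 (funext fun t => ?_)⟩
    rw [radial, hφ, Measure.restrict_eq_self_of_ae_mem hae]
    refine integral_congr_ae ?_
    filter_upwards [hae] with s hs
    have hs' : 0 < s := hs
    simp only [R, if_pos hs', coe_nnnorm]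
    congr 1
    field_simp

/-! ### The radius distribution is determined by the tail correlation function -/

/-- The distribution on `[0,1]` with survival function `h_d`. -/
def hLaw (d : ℕ) : Measure ℝ :=
  (volume.restrict (Set.Ioc 0 1)).withDensity fun v => ENNReal.ofReal
    (d * Real.Gamma (d / 2) / (√Real.pi * Real.Gamma ((d + 1) / 2)) *
      (1 - v ^ 2) ^ (((d : ℝ) - 1) / 2))

theorem hFun_coeff_pos {d : ℕ} (hd : 1 ≤ d) :
    0 < d * Real.Gamma (d / 2) / (√Real.pi * Real.Gamma ((d + 1) / 2)) := by
  have hd' : (0 : ℝ) < d := by exact_mod_cast hd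
  have := Real.Gamma_pos_of_pos (half_pos hd')
  have := Real.Gamma_pos_of_pos (by positivity : (0 : ℝ) < (d + 1) / 2)
  have := Real.pi_pos
  positivity

theorem hLaw_Ici {d : ℕ} (hd : 1 ≤ d) {s : ℝ} (hs : 0 ≤ s) :
    hLaw d (Set.Ici s) = ENNReal.ofReal (hFun d s) := by
  have hc := hFun_coeff_pos hd
  have hset : (Set.Ici s ∩ Set.Ioc 0 1 : Set ℝ) =ᵐ[volume] (Set.Icc s 1 : Set ℝ) := by
    rcases hs.eq_or_lt with rfl | h
    · rw [Set.inter_eq_right.2 fun x hx => hx.1.le]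
      exact Ioc_ae_eq_Icc
    · have heq : (Set.Ici s ∩ Set.Ioc 0 1 : Set ℝ) = Set.Icc s 1 := Set.ext fun v =>
        ⟨fun hv => ⟨hv.1, hv.2.2⟩, fun hv => ⟨hv.1, h.trans_le hv.1, hv.2⟩⟩
      exact heq ▸ ae_eq_refl _
  obtain ⟨n, rfl⟩ := Nat.exists_eq_add_of_le' hd
  have hexp : (((n + 1 : ℕ) : ℝ) - 1) / 2 = (n : ℝ) / 2 := by push_cast; ring
  rw [hLaw, withDensity_apply _ measurableSet_Ici, Measure.restrict_restrict measurableSet_Ici,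
    setLIntegral_congr hset, hFun]
  simp only [ENNReal.ofReal_mul hc.le, hexp]
  rw [lintegral_const_mul' _ _ ENNReal.ofReal_ne_top, lintegral_hFun_density n hs]

theorem hFun_zero {d : ℕ} (hd : 1 ≤ d) : hFun d 0 = 1 := by
  have h := volume_unit_lens hd (0 : E d)
  rw [Set.inter_self, norm_zero, zero_div] at h
  have h2 : ENNReal.ofReal (hFun d 0) = 1 := by
    have h3 : kappa d * 1 = kappa d * ENNReal.ofReal (hFun d 0) := by rw [mul_one]; exact h
    exact ((ENNReal.mul_right_inj (kappa_pos d).ne' (kappa_ne_top d)).1 h3).symm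
  rwa [ENNReal.ofReal_eq_one] at h2

theorem hLaw_ae_pos (d : ℕ) : ∀ᵐ v ∂(hLaw d), 0 < v := by
  have h : ∀ᵐ v ∂(volume.restrict (Set.Ioc (0 : ℝ) 1)), 0 < v := by
    filter_upwards [ae_restrict_mem measurableSet_Ioc] with v hv using hv.1
  exact (withDensity_absolutelyContinuous _ _).ae_le h

theorem isProbabilityMeasure_hLaw {d : ℕ} (hd : 1 ≤ d) : IsProbabilityMeasure (hLaw d) := by
  constructor
  rw [← measure_eq_measure_of_null_sdiff (Set.subset_univ (Set.Ici (0 : ℝ))) ?_, hLaw_Ici hd le_rfl,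
    hFun_zero hd, ENNReal.ofReal_one]
  refine measure_mono_null ?_ (ae_iff.1 (hLaw_ae_pos d))
  rintro v ⟨_, hv⟩ h
  exact hv (le_of_lt h)

/-- Substituting `x = v²` turns `∫ v^{iy} (1 - v²)^{(d-1)/2} dv` into half the Beta integral at `(1
+ iy)/2` and `(d+1)/2`. Its product with a Gamma value is a product of two Gamma values in the right
half-plane, hence nonzero. -/
theorem integral_exp_log_hLaw_ne_zero {d : ℕ} (hd : 1 ≤ d) (y : ℝ) :
    ∫ v, Complex.exp (y * Real.log v * Complex.I) ∂(hLaw d) ≠ 0 := by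
  have hc := hFun_coeff_pos hd
  have hd' : (1 : ℝ) ≤ d := by exact_mod_cast hd
  set c := d * Real.Gamma (d / 2) / (√Real.pi * Real.Gamma ((d + 1) / 2))
  set u : ℂ := (1 + y * Complex.I) / 2
  set w : ℂ := ((d : ℂ) + 1) / 2
  have hu : 0 < u.re := by simp [u]
  have hw : 0 < w.re := by
    simp only [w, Complex.div_ofNat_re, Complex.add_re, Complex.natCast_re, Complex.one_re]
    linarith
  have hdens : ∀ v ∈ Set.Ioc (0 : ℝ) 1, 0 ≤ c * (1 - v ^ 2) ^ (((d : ℝ) - 1) / 2) := fun v hv =>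
    mul_nonneg hc.le (Real.rpow_nonneg (by nlinarith [hv.1, hv.2]) _)
  have hbeta : Complex.betaIntegral u w ≠ 0 := by
    intro h0
    have h := Complex.Gamma_mul_Gamma_eq_betaIntegral hu hw
    rw [h0, mul_zero] at h
    exact mul_ne_zero (Complex.Gamma_ne_zero_of_re_pos hu) (Complex.Gamma_ne_zero_of_re_pos hw) h
  have hsubst := integral_comp_rpow_Ioi_of_pos (E := ℂ)
    (g := (Set.Ioc (0 : ℝ) 1).indicator fun x => (x : ℂ) ^ (u - 1) * (1 - (x : ℂ)) ^ (w - 1))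
    (p := 2) two_pos
  have hrhs : ∫ x in Set.Ioi (0 : ℝ), (Set.Ioc (0 : ℝ) 1).indicator
      (fun x => (x : ℂ) ^ (u - 1) * (1 - (x : ℂ)) ^ (w - 1)) x = Complex.betaIntegral u w := by
    rw [setIntegral_indicator measurableSet_Ioc, Complex.betaIntegral,
      intervalIntegral.integral_of_le zero_le_one, Set.inter_eq_right.2 fun x hx => hx.1]
  have hlhs : ∫ v, Complex.exp (y * Real.log v * Complex.I) ∂(hLaw d) =
      (c / 2 : ℂ) * Complex.betaIntegral u w := by
    rw [← hrhs, ← hsubst, hLaw, integral_withDensity_eq_integral_toReal_smul₀]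
    · rw [← integral_const_mul]
      have hsub : Set.Ioc (0 : ℝ) 1 = Set.Ioi 0 ∩ Set.Ioc 0 1 :=
        (Set.inter_eq_right.2 fun x hx => hx.1).symm
      conv_lhs => rw [hsub, ← setIntegral_indicator measurableSet_Ioc]
      refine setIntegral_congr_fun measurableSet_Ioi fun v hv => ?_
      have hv0 : 0 < v := hv
      by_cases h1 : v ≤ 1
      · have hmem : v ∈ Set.Ioc (0 : ℝ) 1 := ⟨hv0, h1⟩
        have hmem2 : v ^ (2 : ℝ) ∈ Set.Ioc (0 : ℝ) 1 :=
          ⟨Real.rpow_pos_of_pos hv0 _, Real.rpow_le_one hv0.le h1 zero_le_two⟩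
        have h1v : 0 ≤ 1 - v ^ 2 := by nlinarith
        simp only [Set.indicator_of_mem hmem, Set.indicator_of_mem hmem2]
        rw [ENNReal.toReal_ofReal (hdens v hmem)]
        have hpow : ((v ^ (2 : ℝ) : ℝ) : ℂ) ^ (u - 1) * v =
            Complex.exp (y * Real.log v * Complex.I) := by
          have hv2 : (0 : ℝ) < v ^ (2 : ℝ) := hmem2.1
          rw [Complex.cpow_def_of_ne_zero (by exact_mod_cast hv2.ne'), ← Complex.ofReal_log hv2.le,
            Real.log_rpow hv0]
          nth_rw 2 [← Real.exp_log hv0]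
          rw [Complex.ofReal_exp, ← Complex.exp_add]
          congr 1
          simp only [u]
          push_cast
          ring
        have hpow2 : (1 - ((v ^ (2 : ℝ) : ℝ) : ℂ)) ^ (w - 1) =
            (((1 - v ^ 2) ^ (((d : ℝ) - 1) / 2) : ℝ) : ℂ) := by
          rw [Complex.ofReal_cpow h1v]
          simp only [w]
          push_cast
          norm_num
          congr 1
          ring
        rw [← hpow, hpow2]
        have hv1 : v ^ ((2 : ℝ) - 1) = v := by norm_num
        rw [hv1]
        simp only [Complex.real_smul]
        push_cast
        ring
      · have hmem : v ∉ Set.Ioc (0 : ℝ) 1 := fun h => h1 h.2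
        have hmem2 : v ^ (2 : ℝ) ∉ Set.Ioc (0 : ℝ) 1 := fun h =>
          not_le.2 (Real.one_lt_rpow (not_le.1 h1) two_pos) h.2
        simp only [Set.indicator_of_notMem hmem, Set.indicator_of_notMem hmem2, smul_zero, mul_zero]
    · fun_prop
    · exact Eventually.of_forall fun v => ENNReal.ofReal_lt_top
  rw [hlhs]
  refine mul_ne_zero ?_ hbeta
  have : (c : ℂ) ≠ 0 := by exact_mod_cast hc.ne'
  exact div_ne_zero this two_ne_zero

section Uniqueness

variable {F F' : Type} [MeasurableSpace F] [MeasurableSpace F'] {Q : Measure F} {R : F → ℝ}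
  {Q' : Measure F'} {R' : F' → ℝ} {d : ℕ}

/-- Given the radius, `2RV ≥ t` means `V ≥ t/(2R)`. This exhibits the TCF as the survival function
of a product of independent variables. -/
theorem IsRandomRadius.prod_hLaw_Ici (h : IsRandomRadius Q R) (hd : 1 ≤ d) {t : ℝ} (ht : 0 ≤ t) :
    ((Q.prod (hLaw d)).map fun q => 2 * R q.1 * q.2) (Set.Ici t) =
      ∫⁻ a, ENNReal.ofReal (hFun d (t / (2 * R a))) ∂Q := by
  have := h.isProb
  have := isProbabilityMeasure_hLaw hd
  have hR := h.measurable
  have hm : Measurable fun q : F × ℝ => 2 * R q.1 * q.2 := by fun_prop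
  rw [Measure.map_apply hm measurableSet_Ici, Measure.prod_apply (hm measurableSet_Ici)]
  refine lintegral_congr fun a => ?_
  have hpos : 0 < 2 * R a := mul_pos two_pos (h.pos a)
  have : Prod.mk a ⁻¹' ((fun q : F × ℝ => 2 * R q.1 * q.2) ⁻¹' Set.Ici t) =
      Set.Ici (t / (2 * R a)) := by
    ext v
    simp only [Set.mem_preimage, Set.mem_Ici, div_le_iff₀ hpos, mul_comm v]
  rw [this, hLaw_Ici hd (div_nonneg ht hpos.le)]

/-- The logarithm turns the product `2R · V` into a sum of independent variables. -/
theorem IsRandomRadius.charFun_log (h : IsRandomRadius Q R) (hd : 1 ≤ d) (y : ℝ) :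
    ∫ x, Complex.exp (y * Real.log x * Complex.I)
        ∂((Q.prod (hLaw d)).map fun q => 2 * R q.1 * q.2) =
      charFun (Q.map fun a => Real.log (2 * R a)) y *
        ∫ v, Complex.exp (y * Real.log v * Complex.I) ∂(hLaw d) := by
  have := h.isProb
  have := isProbabilityMeasure_hLaw hd
  have hR := h.measurable
  have hm : Measurable fun q : F × ℝ => 2 * R q.1 * q.2 := by fun_prop
  have hm' : Measurable fun a => Real.log (2 * R a) := by fun_prop
  rw [integral_map hm.aemeasurable (Measurable.aestronglyMeasurable (by fun_prop)),
    charFun_apply_real,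
    integral_map hm'.aemeasurable (Measurable.aestronglyMeasurable (by fun_prop)),
    ← integral_prod_mul]
  refine integral_congr_ae ?_
  have hae : ∀ᵐ q ∂(Q.prod (hLaw d)), 0 < q.2 :=
    Measure.quasiMeasurePreserving_snd.ae (hLaw_ae_pos d)
  filter_upwards [hae] with q hq
  rw [Real.log_mul (mul_pos two_pos (h.pos _)).ne' hq.ne', ← Complex.exp_add]
  congr 1
  push_cast
  ring

/-- The distribution of the radius is determined by the tail correlation function. -/
theorem IsRandomRadius.map_eq_map (h : IsRandomRadius Q R) (h' : IsRandomRadius Q' R') (hd : 1 ≤ d)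
    (heq : ∀ t : ℝ, 0 ≤ t → ∫⁻ a, ENNReal.ofReal (hFun d (t / (2 * R a))) ∂Q =
      ∫⁻ a, ENNReal.ofReal (hFun d (t / (2 * R' a))) ∂Q') : Q.map R = Q'.map R' := by
  have := h.isProb
  have := h'.isProb
  have := isProbabilityMeasure_hLaw hd
  have hR := h.measurable
  have hR' := h'.measurable
  have hm : Measurable fun q : F × ℝ => 2 * R q.1 * q.2 := by fun_prop
  have hm' : Measurable fun q : F' × ℝ => 2 * R' q.1 * q.2 := by fun_prop
  have hl : Measurable fun a => Real.log (2 * R a) := by fun_prop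
  have hl' : Measurable fun a => Real.log (2 * R' a) := by fun_prop
  have := Measure.isProbabilityMeasure_map (μ := Q.prod (hLaw d)) hm.aemeasurable
  have := Measure.isProbabilityMeasure_map (μ := Q'.prod (hLaw d)) hm'.aemeasurable
  have := Measure.isProbabilityMeasure_map (μ := Q) hl.aemeasurable
  have := Measure.isProbabilityMeasure_map (μ := Q') hl'.aemeasurable
  have hIci : ∀ t : ℝ, 0 ≤ t → ((Q.prod (hLaw d)).map fun q => 2 * R q.1 * q.2) (Set.Ici t) =
      ((Q'.prod (hLaw d)).map fun q => 2 * R' q.1 * q.2) (Set.Ici t) := fun t ht => by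
    rw [h.prod_hLaw_Ici hd ht, h'.prod_hLaw_Ici hd ht, heq t ht]
  have hone : ((Q.prod (hLaw d)).map fun q => 2 * R q.1 * q.2) (Set.Ici 0) = 1 := by
    rw [h.prod_hLaw_Ici hd le_rfl]
    simp [hFun_zero hd]
  have hlaw : ((Q.prod (hLaw d)).map fun q => 2 * R q.1 * q.2) =
      ((Q'.prod (hLaw d)).map fun q => 2 * R' q.1 * q.2) := by
    -- The hypothesis covers `t ≥ 0`; for `t ≤ 0` both half-lines have full mass, since `[0,∞)`
    -- already does.
    refine Measure.ext_of_Ici _ _ fun t => ?_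
    rcases le_total 0 t with ht | ht
    · exact hIci t ht
    · rw [le_antisymm prob_le_one (hone.ge.trans (measure_mono (Set.Ici_subset_Ici.2 ht))),
        le_antisymm prob_le_one ((hIci 0 le_rfl ▸ hone).ge.trans
          (measure_mono (Set.Ici_subset_Ici.2 ht)))]
  have hchar : Q.map (fun a => Real.log (2 * R a)) = Q'.map fun a => Real.log (2 * R' a) := by
    refine Measure.ext_of_charFun (funext fun y => ?_)
    have h1 := h.charFun_log hd y
    rw [hlaw, h'.charFun_log hd y] at h1
    exact (mul_right_cancel₀ (integral_exp_log_hLaw_ne_zero hd y) h1).symm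
  have hexp : Measurable fun x : ℝ => Real.exp x / 2 := by fun_prop
  have hback := congrArg (Measure.map fun x : ℝ => Real.exp x / 2) hchar
  rw [Measure.map_map hexp hl, Measure.map_map hexp hl'] at hback
  have h1 : (fun x : ℝ => Real.exp x / 2) ∘ (fun a => Real.log (2 * R a)) = R := by
    funext a
    simp [Real.exp_log (mul_pos two_pos (h.pos a))]
  have h2 : (fun x : ℝ => Real.exp x / 2) ∘ (fun a => Real.log (2 * R' a)) = R' := by
    funext a
    simp [Real.exp_log (mul_pos two_pos (h'.pos a))]
  rwa [h1, h2] at hback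

end Uniqueness

/-! ### Radial non-increasing shapes -/

/-- The overlap `∫ g(max(‖z‖, ‖t - z‖)) dz` of a radial shape with its translate. -/
def radialOverlap (d : ℕ) (g : ℝ≥0 → ℝ≥0∞) (t : E d) : ℝ≥0∞ :=
  ∫⁻ z : E d, g (max ‖z‖₊ ‖t - z‖₊)

/-- The right-hand side is linear in `g`, whereas a minimum is not; this is why only the mean of a
random profile matters. -/
theorem radial_min {d : ℕ} {g : ℝ≥0 → ℝ≥0∞} (hg : Antitone g) (t z : E d) :
    min (radial d g (-z)) (radial d g (t - z)) = g (max ‖z‖₊ ‖t - z‖₊) := by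
  rw [radial, radial, nnnorm_neg, hg.map_max]

theorem isM2rTCF_iff {d : ℕ} {g : ℝ≥0 → ℝ≥0∞} (hg : Antitone g) {χ : E d → ℝ} :
    IsM2rTCF d g χ ↔ IsM2rShape d g ∧ χ = fun t => (radialOverlap d g t).toReal := by
  unfold IsM2rTCF
  rw [isM3TCF_iff]
  have h1 : IsRandomShape d (Measure.dirac ()) (fun _ : Unit => radial d g) ↔ IsM2rShape d g := by
    refine ⟨fun h => ⟨hg, by simpa using h.integral_eq_one⟩, fun h => ⟨inferInstance, ?_, ?_⟩⟩
    · exact (hg.measurable.comp measurable_nnnorm).comp measurable_snd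
    · simpa using h.integral_eq_one
  have h2 : ∀ t, shapeOverlap d (Measure.dirac ()) (fun _ : Unit => radial d g) t =
      radialOverlap d g t := fun t => by
    simp [shapeOverlap, radialOverlap, radial_min hg]
  simp only [h1, h2]

section Mean

variable {F : Type} [MeasurableSpace F] {d : ℕ} {Q : Measure F} {f : F → E d → ℝ≥0∞}

/-- The mean `E f(x)` of a random shape at the points `x` with `‖x‖ = r`. -/
def meanShape {F : Type} [MeasurableSpace F] {d : ℕ} (hd : 1 ≤ d) (Q : Measure F)
    (f : F → E d → ℝ≥0∞) (r : ℝ≥0) : ℝ≥0∞ :=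
  -- Evaluating `f a` on the first axis avoids choosing a profile for each `a`.
  ∫⁻ a, f a (EuclideanSpace.single ⟨0, hd⟩ (r : ℝ)) ∂Q

theorem radial_eq_single {d : ℕ} (hd : 1 ≤ d) {f : E d → ℝ≥0∞} {g : ℝ≥0 → ℝ≥0∞}
    (hf : f = radial d g) (r : ℝ≥0) : f (EuclideanSpace.single ⟨0, hd⟩ (r : ℝ)) = g r := by
  rw [hf, radial]
  congr 1
  ext
  simp

theorem meanShape_antitone (hd : 1 ≤ d)
    (hf : ∀ a, ∃ g : ℝ≥0 → ℝ≥0∞, Antitone g ∧ f a = radial d g) :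
    Antitone (meanShape hd Q f) := by
  intro r s hrs
  refine lintegral_mono fun a => ?_
  obtain ⟨g, hg, hfg⟩ := hf a
  simpa only [radial_eq_single hd hfg] using hg hrs

theorem IsRandomShape.isM2rShape_meanShape (h : IsRandomShape d Q f) (hd : 1 ≤ d)
    (hf : ∀ a, ∃ g : ℝ≥0 → ℝ≥0∞, Antitone g ∧ f a = radial d g) :
    IsM2rShape d (meanShape hd Q f) := by
  have := h.isProb
  refine ⟨meanShape_antitone hd hf, ?_⟩
  have : ∀ x : E d, radial d (meanShape hd Q f) x = ∫⁻ a, f a x ∂Q := by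
    intro x
    refine lintegral_congr fun a => ?_
    obtain ⟨g, hg, hfg⟩ := hf a
    rw [radial_eq_single hd hfg, hfg, radial]
  simp only [this]
  rw [← lintegral_lintegral_swap h.measurable.aemeasurable]
  exact h.integral_eq_one

theorem IsRandomShape.radialOverlap_meanShape (h : IsRandomShape d Q f) (hd : 1 ≤ d)
    (hf : ∀ a, ∃ g : ℝ≥0 → ℝ≥0∞, Antitone g ∧ f a = radial d g) (t : E d) :
    radialOverlap d (meanShape hd Q f) t = shapeOverlap d Q f t := by
  have := h.isProb
  have hm : ∀ s : E d, Measurable fun p : F × E d => f p.1 (s - p.2) := fun s =>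
    h.measurable.comp (measurable_fst.prodMk (measurable_const.sub measurable_snd))
  unfold shapeOverlap
  rw [lintegral_lintegral_swap]
  · refine lintegral_congr fun z => lintegral_congr fun a => ?_
    obtain ⟨g, hg, hfg⟩ := hf a
    rw [radial_eq_single hd hfg, hfg, radial_min hg]
  · have := (hm 0).min (hm t)
    simp only [zero_sub] at this
    exact this.aemeasurable

theorem ballShape_eq_radial (d : ℕ) {r : ℝ} (hr : 0 ≤ r) :
    ∃ g : ℝ≥0 → ℝ≥0∞, Antitone g ∧ ballShape d r = radial d g := by
  refine ⟨(Set.Iic r.toNNReal).indicator fun _ => (volume (Metric.closedBall (0 : E d) r))⁻¹,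
    fun a b hab => ?_, funext fun x => ?_⟩
  · simp only [Set.indicator_apply, Set.mem_Iic]
    split_ifs with h1 h2
    · exact le_rfl
    · exact absurd (hab.trans h1) h2
    · exact zero_le
    · exact le_rfl
  · have hx : x ∈ Metric.closedBall (0 : E d) r ↔ ‖x‖₊ ∈ Set.Iic r.toNNReal := by
      rw [mem_closedBall_zero_iff, Set.mem_Iic, ← NNReal.coe_le_coe, coe_nnnorm,
        Real.coe_toNNReal r hr]
    by_cases h : x ∈ Metric.closedBall (0 : E d) r
    · rw [ballShape, radial, Set.indicator_of_mem h, Set.indicator_of_mem (hx.1 h)]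
    · rw [ballShape, radial, Set.indicator_of_notMem h,
        Set.indicator_of_notMem fun h' => h (hx.2 h')]

theorem tcfM3r_subset_tcfM2r (hd : 1 ≤ d) : tcfM3r d ⊆ tcfM2r d := by
  rintro χ ⟨F, _, Q, f, hf, hχ⟩
  rw [isM3TCF_iff] at hχ
  refine ⟨meanShape hd Q f, meanShape_antitone hd hf,
    (isM2rTCF_iff (meanShape_antitone hd hf)).2 ⟨hχ.1.isM2rShape_meanShape hd hf, ?_⟩⟩
  rw [hχ.2]
  funext t
  rw [hχ.1.radialOverlap_meanShape hd hf]

theorem tcfM2r_subset_tcfM3r : tcfM2r d ⊆ tcfM3r d := by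
  rintro χ ⟨g, hg, hχ⟩
  exact ⟨Unit, inferInstance, Measure.dirac (), fun _ => radial d g, fun _ => ⟨g, hg, rfl⟩, hχ⟩

theorem tcfM3b_subset_tcfM3r : tcfM3b d ⊆ tcfM3r d := by
  rintro χ ⟨F, mF, Q, R, hR, hχ⟩
  exact ⟨F, mF, Q, fun a => ballShape d (R a), fun a => ballShape_eq_radial d (hR.pos a).le, hχ⟩

end Mean

/-! ### The distribution function of the inverse radius -/

section Cdf

variable {F : Type} [MeasurableSpace F] {d : ℕ} {Q : Measure F} {R : F → ℝ}

theorem IsRandomRadius.measurable_inv (h : IsRandomRadius Q R) : Measurable fun a => (R a)⁻¹ :=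
  h.measurable.inv

theorem IsRandomRadius.measure_cdfInv (h : IsRandomRadius Q R) :
    (cdfInv Q R).measure = Q.map fun a => (R a)⁻¹ := by
  have := h.isProb
  have := Measure.isProbabilityMeasure_map (μ := Q) h.measurable_inv.aemeasurable
  exact measure_cdf _

theorem IsRandomRadius.ofReal_cdfInv (h : IsRandomRadius Q R) (s : ℝ) :
    ENNReal.ofReal (cdfInv Q R s) = (cdfInv Q R).measure (Set.Ioc 0 s) := by
  have := h.isProb
  have := Measure.isProbabilityMeasure_map (μ := Q) h.measurable_inv.aemeasurable
  rw [h.measure_cdfInv, Measure.map_apply h.measurable_inv measurableSet_Ioc]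
  refine (ofReal_cdf (Q.map fun a => (R a)⁻¹) s).trans ?_
  rw [Measure.map_apply h.measurable_inv measurableSet_Iic]
  congr 1
  ext a
  simp [h.pos a]

/-- A point at distance `u` lies in the ball exactly when `1/R ≤ 1/u`, and the indicator then has
height `κ_d⁻¹ (1/R)^d`. At `u = 0` the convention `0⁻¹ = 0` would make the interval empty. -/
theorem IsRandomRadius.meanShape_ballShape (h : IsRandomRadius Q R) (hd : 1 ≤ d) {u : ℝ≥0}
    (hu : 0 < u) :
    meanShape hd Q (fun a => ballShape d (R a)) u = shapeOfCdf d (cdfInv Q R) u := by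
  have hu' : (0 : ℝ) < u := by exact_mod_cast hu
  have hmem : ∀ a, (R a)⁻¹ ∈ Set.Ioc 0 (u : ℝ)⁻¹ ↔ (u : ℝ) ≤ R a := fun a => by
    rw [Set.mem_Ioc, and_iff_right (inv_pos.2 (h.pos a)), inv_le_inv₀ (h.pos a) hu']
  rw [shapeOfCdf, h.measure_cdfInv, ← lintegral_indicator measurableSet_Ioc,
    lintegral_map (Measurable.indicator (by fun_prop) measurableSet_Ioc) h.measurable_inv,
    ← lintegral_const_mul' _ _ (ENNReal.inv_ne_top.2 (kappa_pos d).ne')]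
  refine lintegral_congr fun a => ?_
  have hx : EuclideanSpace.single (⟨0, hd⟩ : Fin d) (u : ℝ) ∈ Metric.closedBall (0 : E d) (R a) ↔
      (u : ℝ) ≤ R a := by
    simp
  change ballShape d (R a) (EuclideanSpace.single (⟨0, hd⟩ : Fin d) (u : ℝ)) = _
  by_cases hua : (u : ℝ) ≤ R a
  · rw [Set.indicator_of_mem ((hmem a).2 hua), ballShape, Set.indicator_of_mem (hx.2 hua),
      volume_closedBall_eq d 0 (h.pos a).le, ENNReal.mul_inv (Or.inr (kappa_ne_top d))
        (Or.inl ENNReal.ofReal_ne_top), mul_comm, inv_pow,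
      ENNReal.ofReal_inv_of_pos (pow_pos (h.pos a) d)]
  · rw [Set.indicator_of_notMem fun h' => hua ((hmem a).1 h'), ballShape,
      Set.indicator_of_notMem fun h' => hua (hx.1 h'), mul_zero]

theorem lintegral_pow_Ioc_ne_top (d : ℕ) (μ : Measure ℝ) [IsFiniteMeasure μ] (s : ℝ) :
    ∫⁻ x in Set.Ioc 0 s, ENNReal.ofReal (x ^ d) ∂μ ≠ ∞ := by
  refine ne_top_of_le_ne_top (b := ENNReal.ofReal (s ^ d) * μ (Set.Ioc 0 s))
    (ENNReal.mul_ne_top ENNReal.ofReal_ne_top (measure_ne_top _ _)) ?_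
  rw [← setLIntegral_const]
  refine setLIntegral_mono measurable_const fun x hx => ENNReal.ofReal_le_ofReal ?_
  exact pow_le_pow_left₀ hx.1.le hx.2 d

end Cdf

theorem restrict_Ioc_eq_of_forall {μ ν : Measure ℝ}
    (hfin : ∀ s : ℝ, 0 < s → μ (Set.Ioc 0 s) ≠ ∞)
    (h : ∀ s : ℝ, 0 < s → μ (Set.Ioc 0 s) = ν (Set.Ioc 0 s)) {s : ℝ} (hs : 0 < s) :
    μ.restrict (Set.Ioc 0 s) = ν.restrict (Set.Ioc 0 s) := by
  have : IsFiniteMeasure (μ.restrict (Set.Ioc 0 s)) :=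
    ⟨by rw [Measure.restrict_apply_univ]; exact (hfin s hs).lt_top⟩
  refine Measure.ext_of_Iic _ _ fun t => ?_
  rw [Measure.restrict_apply measurableSet_Iic, Measure.restrict_apply measurableSet_Iic,
    Set.inter_comm, Set.Ioc_inter_Iic]
  rcases lt_or_ge 0 (min s t) with hm | hm
  · exact h _ hm
  · rw [Set.Ioc_eq_empty (not_lt.2 hm), measure_empty, measure_empty]

/-- Inversion of a density on `(0,∞)`. -/
theorem forall_Ioc_eq_lintegral_inv {μ ν : Measure ℝ} {v w : ℝ → ℝ≥0∞} (hv : Measurable v)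
    (hw : Measurable w) (hvw : ∀ x, 0 < x → v x * w x = 1)
    (hfin : ∀ s : ℝ, 0 < s → μ (Set.Ioc 0 s) ≠ ∞)
    (h : ∀ s : ℝ, 0 < s → μ (Set.Ioc 0 s) = ∫⁻ x in Set.Ioc 0 s, v x ∂ν) (s : ℝ) (hs : 0 < s) :
    ν (Set.Ioc 0 s) = ∫⁻ x in Set.Ioc 0 s, w x ∂μ := by
  have hr : μ.restrict (Set.Ioc 0 s) = (ν.withDensity v).restrict (Set.Ioc 0 s) :=
    restrict_Ioc_eq_of_forall hfin
      (fun t ht => by rw [h t ht, withDensity_apply _ measurableSet_Ioc]) hs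
  have h1 : ∫⁻ x in Set.Ioc 0 s, (v * w) x ∂ν = ∫⁻ _ in Set.Ioc 0 s, 1 ∂ν :=
    setLIntegral_congr_fun measurableSet_Ioc fun x hx => hvw x hx.1
  rw [hr, restrict_withDensity measurableSet_Ioc, lintegral_withDensity_eq_lintegral_mul _ hv hw,
    h1, setLIntegral_one]

/-! ### The Lebesgue–Stieltjes measure of a shape -/

/-- Spheres are null sets, so the countably many discontinuities of a profile are invisible to
integrals over `ℝ^d`. -/
theorem ae_norm_sub_notMem {d : ℕ} (hd : 1 ≤ d) {C : Set ℝ} (hC : C.Countable) (t : E d) :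
    ∀ᵐ z : E d, ‖t - z‖ ∉ C := by
  have : Nonempty (Fin d) := ⟨⟨0, hd⟩⟩
  have hset : {z : E d | ¬ ‖t - z‖ ∉ C} = ⋃ c ∈ C, Metric.sphere t c := by
    ext z
    simp [norm_sub_rev z t]
  rw [ae_iff, hset, measure_biUnion_null_iff hC]
  exact fun c _ => Measure.addHaar_sphere volume t c

section Shape

variable {d : ℕ} {g : ℝ≥0 → ℝ≥0∞}

theorem IsM2rShape.ofReal_recipFun (hg : IsM2rShape d g) {s : ℝ} (hs : 0 < s) :
    ENNReal.ofReal (recipFun g s) = g s⁻¹.toNNReal := by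
  rw [recipFun, if_neg (not_le.2 hs), ENNReal.ofReal_toReal (hg.ne_top (by simpa using hs))]

/-- A positive limit of `g` at infinity would make its integral over `ℝ^d` infinite. Hence
`d[g(1/u)]` determines `g` without an additive constant. -/
theorem IsM2rShape.rightLim_recipFun_zero (hg : IsM2rShape d g) (hd : 1 ≤ d) :
    Function.rightLim (recipFun g) 0 = 0 := by
  have : Nonempty (Fin d) := ⟨⟨0, hd⟩⟩
  set c := Function.rightLim (recipFun g) 0
  have h0 : 0 ≤ c := by
    have := hg.monotone_recipFun.le_rightLim (le_refl (0 : ℝ))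
    simpa [recipFun] using this
  by_contra hne
  have hc : 0 < c := lt_of_le_of_ne h0 (Ne.symm hne)
  have hle : ∀ᵐ x : E d, ENNReal.ofReal c ≤ radial d g x := by
    filter_upwards [ae_norm_sub_notMem hd (Set.countable_singleton 0) (0 : E d)] with x hx
    simp only [zero_sub, norm_neg, Set.mem_singleton_iff, norm_eq_zero] at hx
    have hpos : 0 < ‖x‖ := norm_pos_iff.2 hx
    have h1 : c ≤ recipFun g ‖x‖⁻¹ := hg.monotone_recipFun.rightLim_le (inv_pos.2 hpos)
    refine (ENNReal.ofReal_le_ofReal h1).trans ?_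
    rw [hg.ofReal_recipFun (inv_pos.2 hpos), inv_inv, radial, norm_toNNReal]
  have h2 := lintegral_mono_ae hle
  rw [lintegral_const, measure_univ_of_isAddLeftInvariant, hg.integral_eq_one,
    ENNReal.mul_top (ENNReal.ofReal_pos.2 hc).ne'] at h2
  exact absurd h2 (by simp)

theorem IsM2rShape.shapeMeasure_Ioc (hg : IsM2rShape d g) (hd : 1 ≤ d) (s : ℝ) :
    shapeMeasure hg (Set.Ioc 0 s) = ENNReal.ofReal (Function.rightLim (recipFun g) s) := by
  rw [shapeMeasure, StieltjesFunction.measure_Ioc, Monotone.stieltjesFunction_eq,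
    Monotone.stieltjesFunction_eq, hg.rightLim_recipFun_zero hd, sub_zero]

/-- Left-continuity of `g` at `u` is right-continuity of `s ↦ g(1/s)` at `1/u`, and the Stieltjes
measure sees the right-continuous version. -/
theorem IsM2rShape.eq_shapeMeasure (hg : IsM2rShape d g) (hd : 1 ≤ d) {u : ℝ≥0} (hu : 0 < u)
    (hcont : ContinuousWithinAt g (Set.Iic u) u) :
    g u = shapeMeasure hg (Set.Ioc 0 (u : ℝ)⁻¹) := by
  have hu' : (0 : ℝ) < u := by exact_mod_cast hu
  have hinv : Tendsto (fun s : ℝ => s⁻¹.toNNReal) (𝓝[>] (u : ℝ)⁻¹) (𝓝[≤] u) := by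
    refine tendsto_nhdsWithin_iff.2 ⟨?_, ?_⟩
    · have h1 : ContinuousAt (fun s : ℝ => s⁻¹.toNNReal) (u : ℝ)⁻¹ :=
        (continuous_real_toNNReal.continuousAt).comp (continuousAt_inv₀ (inv_pos.2 hu').ne')
      have h2 := h1.tendsto.mono_left (nhdsWithin_le_nhds (s := Set.Ioi (u : ℝ)⁻¹))
      simpa using h2
    · filter_upwards [self_mem_nhdsWithin] with s hs
      have hs' : (u : ℝ)⁻¹ < s := hs
      rw [Set.mem_Iic, Real.toNNReal_le_iff_le_coe]
      exact inv_le_of_inv_le₀ hu' hs'.le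
  have hlim : Tendsto (recipFun g) (𝓝[>] (u : ℝ)⁻¹) (𝓝 (g u).toReal) := by
    refine ((ENNReal.tendsto_toReal (hg.ne_top hu)).comp (hcont.tendsto.comp hinv)).congr' ?_
    filter_upwards [self_mem_nhdsWithin] with s hs
    rw [recipFun, if_neg (not_le.2 ((inv_pos.2 hu').trans hs))]
    rfl
  rw [hg.shapeMeasure_Ioc hd, rightLim_eq_of_tendsto hlim,
    ENNReal.ofReal_toReal (hg.ne_top hu)]

theorem IsM2rShape.continuousAt (hg : IsM2rShape d g) {u : ℝ≥0} (hu : 0 < u)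
    (h : ContinuousAt (recipFun g) (u : ℝ)⁻¹) : ContinuousAt g u := by
  have hu' : (0 : ℝ) < u := by exact_mod_cast hu
  have hinv : ContinuousAt (fun v : ℝ≥0 => (v : ℝ)⁻¹) u :=
    (NNReal.continuous_coe.continuousAt).inv₀ hu'.ne'
  have hcomp : ContinuousAt (fun v : ℝ≥0 => ENNReal.ofReal (recipFun g (v : ℝ)⁻¹)) u :=
    ENNReal.continuous_ofReal.continuousAt.comp
      (ContinuousAt.comp (f := fun v : ℝ≥0 => (v : ℝ)⁻¹) h hinv)
  refine hcomp.congr ?_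
  filter_upwards [lt_mem_nhds hu] with v hv
  rw [hg.ofReal_recipFun (inv_pos.2 (by exact_mod_cast hv)), inv_inv, Real.toNNReal_coe]

theorem IsM2rShape.countable_bad (hg : IsM2rShape d g) :
    {s : ℝ | ¬ ContinuousAt (recipFun g) s⁻¹}.Countable :=
  hg.monotone_recipFun.countable_not_continuousAt.preimage inv_injective

/-- Almost everywhere, a shape agrees with its left-continuous version. -/
theorem IsM2rShape.ae_eq_shapeMeasure (hg : IsM2rShape d g) (hd : 1 ≤ d) (t : E d) :
    ∀ᵐ z : E d, 0 < ‖t - z‖₊ ∧ g ‖t - z‖₊ = shapeMeasure hg (Set.Ioc 0 ‖t - z‖⁻¹) := by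
  filter_upwards [ae_norm_sub_notMem hd hg.countable_bad t,
    ae_norm_sub_notMem hd (Set.countable_singleton 0) t] with z hz hz0
  have hpos : 0 < ‖t - z‖₊ := pos_iff_ne_zero.2 fun h => hz0 (by simpa using h)
  have hcont : ContinuousAt (recipFun g) ‖t - z‖⁻¹ := not_not.1 hz
  exact ⟨hpos, hg.eq_shapeMeasure hd hpos (hg.continuousAt hpos hcont).continuousWithinAt⟩

theorem IsM2rShape.radialOverlap_eq (hg : IsM2rShape d g) (hd : 1 ≤ d) (t : E d) :
    radialOverlap d g t =
      ∫⁻ z : E d, shapeMeasure hg (Set.Ioc 0 (max ‖z‖ ‖t - z‖)⁻¹) := by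
  refine lintegral_congr_ae ?_
  filter_upwards [hg.ae_eq_shapeMeasure hd t, hg.ae_eq_shapeMeasure hd 0] with z h1 h2
  simp only [zero_sub, norm_neg, nnnorm_neg] at h2
  rcases le_total ‖z‖₊ ‖t - z‖₊ with h | h
  · have h' : ‖z‖ ≤ ‖t - z‖ := h
    rw [max_eq_right h, max_eq_right h', h1.2]
  · have h' : ‖t - z‖ ≤ ‖z‖ := h
    rw [max_eq_left h, max_eq_left h', h2.2]

theorem IsM2rShape.shapeMeasure_Ioc_ne_top (hg : IsM2rShape d g) (s : ℝ) :
    shapeMeasure hg (Set.Ioc 0 s) ≠ ∞ := by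
  rw [shapeMeasure, StieltjesFunction.measure_Ioc]
  exact ENNReal.ofReal_ne_top

/-- The total mass of `κ_d u^{-d} d[g(1/u)]` is one. -/
theorem IsM2rShape.lintegral_shapeMeasure (hg : IsM2rShape d g) (hd : 1 ≤ d) :
    ∫⁻ u in Set.Ioi 0, kappa d * ENNReal.ofReal ((u ^ d)⁻¹) ∂(shapeMeasure hg) = 1 := by
  have hsf : SFinite (shapeMeasure hg) := by
    unfold shapeMeasure
    infer_instance
  -- Tonelli on this region: its section at `u` is a ball of volume `κ_d u^{-d}`, and its section at
  -- `x ≠ 0` is `(0, 1/‖x‖]`, of mass `g(‖x‖)` for almost every `x`.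
  set A : Set (ℝ × E d) := {q | 0 < q.1 ∧ ‖q.2‖ ≤ q.1⁻¹}
  have hA : MeasurableSet A :=
    (measurableSet_lt measurable_const measurable_fst).inter
      (measurableSet_le (f := fun q : ℝ × E d => ‖q.2‖) (by fun_prop)
        (g := fun q : ℝ × E d => q.1⁻¹) (by fun_prop))
  have h1 : (shapeMeasure hg).prod volume A =
      ∫⁻ u in Set.Ioi 0, kappa d * ENNReal.ofReal ((u ^ d)⁻¹) ∂(shapeMeasure hg) := by
    rw [Measure.prod_apply hA, ← lintegral_indicator measurableSet_Ioi]
    refine lintegral_congr fun u => ?_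
    by_cases hu : u ∈ Set.Ioi (0 : ℝ)
    · have hu' : 0 < u := hu
      have hsec : Prod.mk u ⁻¹' A = Metric.closedBall (0 : E d) u⁻¹ := by
        ext x
        simp [A, hu']
      rw [hsec, Set.indicator_of_mem hu, volume_closedBall_eq d 0 (inv_pos.2 hu').le, inv_pow,
        mul_comm]
    · have hu' : ¬ 0 < u := hu
      have hsec : Prod.mk u ⁻¹' A = ∅ := by
        ext x
        simp [A, hu']
      rw [hsec, Set.indicator_of_notMem hu, measure_empty]
  have h2 : (shapeMeasure hg).prod volume A = ∫⁻ x, radial d g x := by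
    rw [Measure.prod_apply_symm hA]
    refine lintegral_congr_ae ?_
    filter_upwards [hg.ae_eq_shapeMeasure hd 0] with x hx
    simp only [zero_sub, norm_neg, nnnorm_neg] at hx
    have hpos : 0 < ‖x‖ := hx.1
    rw [radial, hx.2]
    congr 1
    ext u
    simp only [A, Set.mem_preimage, Set.mem_ofPred_eq, Set.mem_Ioc]
    refine and_congr_right fun hu => ?_
    rw [le_inv_comm₀ hpos hu]
  rw [← h1, h2, hg.integral_eq_one]

end Shape

/-! ### The two inversion formulas and their link with the tail correlation function. -/

section Formulas

variable {d : ℕ} {g : ℝ≥0 → ℝ≥0∞} {F : Type} [MeasurableSpace F] {Q : Measure F} {R : F → ℝ}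

theorem shapeOfCdf_eq (d : ℕ) (H : StieltjesFunction ℝ) (u : ℝ≥0) :
    shapeOfCdf d H u =
      ∫⁻ s in Set.Ioc 0 (u : ℝ)⁻¹, (kappa d)⁻¹ * ENNReal.ofReal (s ^ d) ∂H.measure := by
  rw [shapeOfCdf, lintegral_const_mul' _ _ (ENNReal.inv_ne_top.2 (kappa_pos d).ne')]

theorem tendsto_measure_Ioc_nhdsGT {μ : Measure ℝ} (hfin : ∀ s : ℝ, μ (Set.Ioc 0 s) ≠ ∞) (s : ℝ) :
    Tendsto (fun r => μ (Set.Ioc 0 r)) (𝓝[>] s) (𝓝 (μ (Set.Ioc 0 s))) := by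
  have h := tendsto_measure_biInter_gt (μ := μ) (s := fun r : ℝ => Set.Ioc 0 r) (a := s)
    (fun r _ => measurableSet_Ioc.nullMeasurableSet)
    (fun i j _ hij => Set.Ioc_subset_Ioc_right hij) ⟨s + 1, by simp, hfin _⟩
  have hset : ⋂ r > s, Set.Ioc 0 r = Set.Ioc 0 s := by
    ext x
    simp only [Set.mem_iInter, Set.mem_Ioc]
    refine ⟨fun hx => ⟨(hx (s + 1) (by simp)).1, le_of_forall_gt_imp_ge_of_dense fun r hr =>
      (hx r hr).2⟩, fun hx r hr => ⟨hx.1, hx.2.trans (le_of_lt hr)⟩⟩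
  rw [hset] at h
  exact h

theorem IsRandomRadius.isFiniteMeasure_cdfInv (h : IsRandomRadius Q R) :
    IsFiniteMeasure (cdfInv Q R).measure := by
  have := h.isProb
  rw [h.measure_cdfInv]
  infer_instance

/-- The pointwise formula is known only where `g` is left-continuous. The corresponding `s = 1/u`
include all continuity points of `s ↦ g(1/s)`, a dense set, and both sides of the integrated
identity are right-continuous in `s`. -/
theorem IsM2rShape.shape_formula_iff (hg : IsM2rShape d g) (h : IsRandomRadius Q R) (hd : 1 ≤ d) :
    (∀ u > 0, ContinuousWithinAt g (Set.Iic u) u → g u = shapeOfCdf d (cdfInv Q R) u) ↔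
      ∀ s : ℝ, 0 < s → shapeMeasure hg (Set.Ioc 0 s) =
        ∫⁻ x in Set.Ioc 0 s, (kappa d)⁻¹ * ENNReal.ofReal (x ^ d) ∂(cdfInv Q R).measure := by
  have := h.isFiniteMeasure_cdfInv
  constructor
  · intro hu s hs
    set ρ := (cdfInv Q R).measure.withDensity fun x => (kappa d)⁻¹ * ENNReal.ofReal (x ^ d)
    have hρ : ∀ r, ρ (Set.Ioc 0 r) =
        ∫⁻ x in Set.Ioc 0 r, (kappa d)⁻¹ * ENNReal.ofReal (x ^ d) ∂(cdfInv Q R).measure :=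
      fun r => withDensity_apply _ measurableSet_Ioc
    have hρfin : ∀ r, ρ (Set.Ioc 0 r) ≠ ∞ := fun r => by
      rw [hρ, lintegral_const_mul' _ _ (ENNReal.inv_ne_top.2 (kappa_pos d).ne')]
      exact ENNReal.mul_ne_top (ENNReal.inv_ne_top.2 (kappa_pos d).ne')
        (lintegral_pow_Ioc_ne_top d _ r)
    set D := {r : ℝ | ¬ ContinuousAt (recipFun g) r}ᶜ
    have hD : Dense D := hg.monotone_recipFun.countable_not_continuousAt.dense_compl ℝ
    have hne : (𝓝[Set.Ioi s ∩ D] s).NeBot := by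
      refine mem_closure_iff_nhdsWithin_neBot.1 ?_
      refine closure_minimal (hD.open_subset_closure_inter isOpen_Ioi) isClosed_closure ?_
      rw [closure_Ioi]
      exact Set.self_mem_Ici
    have hle : 𝓝[Set.Ioi s ∩ D] s ≤ 𝓝[>] s := nhdsWithin_mono _ Set.inter_subset_left
    rw [← hρ]
    refine tendsto_nhds_unique
      ((tendsto_measure_Ioc_nhdsGT hg.shapeMeasure_Ioc_ne_top s).mono_left hle)
      (((tendsto_measure_Ioc_nhdsGT hρfin s).mono_left hle).congr' ?_)
    filter_upwards [self_mem_nhdsWithin] with r hr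
    have hr0 : 0 < r := hs.trans hr.1
    have hcont : ContinuousAt (recipFun g) r := not_not.1 hr.2
    have hrinv : ((r⁻¹.toNNReal : ℝ≥0) : ℝ)⁻¹ = r := by
      rw [Real.coe_toNNReal _ (inv_pos.2 hr0).le, inv_inv]
    have hpos : 0 < r⁻¹.toNNReal := by simpa using hr0
    have hcw : ContinuousWithinAt g (Set.Iic r⁻¹.toNNReal) r⁻¹.toNNReal :=
      (hg.continuousAt hpos (by rwa [hrinv])).continuousWithinAt
    have h1 := hg.eq_shapeMeasure hd hpos hcw
    rw [hu _ hpos hcw, shapeOfCdf_eq, hrinv] at h1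
    rw [hρ, h1]
  · intro hs u hu hcont
    rw [shapeOfCdf_eq, hg.eq_shapeMeasure hd hu hcont, hs _ (inv_pos.2 (by exact_mod_cast hu))]

/-- The densities `κ_d x^{-d}` and `κ_d⁻¹ x^d` are reciprocal on `(0,∞)`, so each relation between
`dH` and `d[g(1/u)]` inverts to the other. -/
theorem IsM2rShape.cdf_formula_iff (hg : IsM2rShape d g) (h : IsRandomRadius Q R) :
    (∀ s > 0, ENNReal.ofReal (cdfInv Q R s) = cdfOfShape hg s) ↔
      ∀ s : ℝ, 0 < s → shapeMeasure hg (Set.Ioc 0 s) =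
        ∫⁻ x in Set.Ioc 0 s, (kappa d)⁻¹ * ENNReal.ofReal (x ^ d) ∂(cdfInv Q R).measure := by
  have := h.isFiniteMeasure_cdfInv
  have hmul : ∀ x : ℝ, 0 < x → kappa d * ENNReal.ofReal ((x ^ d)⁻¹) *
      ((kappa d)⁻¹ * ENNReal.ofReal (x ^ d)) = 1 := by
    intro x hx
    have hx' : 0 < x ^ d := pow_pos hx d
    rw [mul_mul_mul_comm, ENNReal.mul_inv_cancel (kappa_pos d).ne' (kappa_ne_top d), one_mul,
      ← ENNReal.ofReal_mul (inv_pos.2 hx').le, inv_mul_cancel₀ hx'.ne', ENNReal.ofReal_one]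
  have hcdf : ∀ s, cdfOfShape hg s =
      ∫⁻ u in Set.Ioc 0 s, kappa d * ENNReal.ofReal ((u ^ d)⁻¹) ∂(shapeMeasure hg) := fun s => by
    rw [cdfOfShape, lintegral_const_mul' _ _ (kappa_ne_top d)]
  simp only [h.ofReal_cdfInv, hcdf]
  constructor
  · intro hs
    exact forall_Ioc_eq_lintegral_inv (by fun_prop) (by fun_prop) hmul
      (fun s _ => measure_ne_top _ _) hs
  · intro hs
    exact forall_Ioc_eq_lintegral_inv (by fun_prop) (by fun_prop)
      (fun x hx => by rw [mul_comm]; exact hmul x hx)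
      (fun s _ => hg.shapeMeasure_Ioc_ne_top s) hs

/-- A shape and a radius that are linked have the same tail correlation function. -/
theorem IsM2rShape.exists_common_tcf (hg : IsM2rShape d g) (h : IsRandomRadius Q R) (hd : 1 ≤ d)
    (hs : ∀ s > 0, ENNReal.ofReal (cdfInv Q R s) = cdfOfShape hg s) :
    ∃ χ, IsM2rTCF d g χ ∧ IsM3bTCF d Q R χ := by
  have hball : ∀ a, ∃ g : ℝ≥0 → ℝ≥0∞, Antitone g ∧ ballShape d (R a) = radial d g := fun a =>
    ballShape_eq_radial d (h.pos a).le
  refine ⟨_, (isM2rTCF_iff hg.antitone).2 ⟨hg, rfl⟩, isM3TCF_iff.2 ⟨h.isRandomShape, ?_⟩⟩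
  funext t
  -- The TCF of the ball process is the overlap of the mean ball shape, so only two deterministic
  -- profiles need comparing, away from the origin.
  rw [← h.isRandomShape.radialOverlap_meanShape hd hball, hg.radialOverlap_eq hd]
  congr 1
  refine lintegral_congr_ae ?_
  filter_upwards [ae_norm_sub_notMem hd (Set.countable_singleton 0) (0 : E d)] with z hz
  simp only [zero_sub, norm_neg, Set.mem_singleton_iff, norm_eq_zero] at hz
  have hpos : 0 < max ‖z‖₊ ‖t - z‖₊ := lt_max_of_lt_left (nnnorm_pos.2 hz)
  rw [h.meanShape_ballShape hd hpos, shapeOfCdf_eq, NNReal.coe_max, coe_nnnorm, coe_nnnorm]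
  exact (hg.cdf_formula_iff h).1 hs _ (inv_pos.2 (lt_max_of_lt_left (norm_pos_iff.2 hz)))

/-- The measure `κ_d u^{-d} d[g(1/u)]` on `(0,∞)` is itself a probability measure; it serves as the
law of `1/R`. -/
theorem IsM2rShape.exists_radius (hg : IsM2rShape d g) (hd : 1 ≤ d) :
    ∃ (F : Type) (_ : MeasurableSpace F) (Q : Measure F) (R : F → ℝ), IsRandomRadius Q R ∧
      ∀ s > 0, ENNReal.ofReal (cdfInv Q R s) = cdfOfShape hg s := by
  set Q : Measure ℝ := ((shapeMeasure hg).restrict (Set.Ioi 0)).withDensity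
    fun u => kappa d * ENNReal.ofReal ((u ^ d)⁻¹)
  let R : ℝ → ℝ := fun u => if 0 < u then u⁻¹ else 1
  have hR : IsRandomRadius Q R := by
    refine ⟨⟨?_⟩, Measurable.ite measurableSet_Ioi (by fun_prop) measurable_const, fun s => ?_⟩
    · rw [withDensity_apply _ MeasurableSet.univ, setLIntegral_univ, hg.lintegral_shapeMeasure hd]
    · simp only [R]
      split_ifs <;> positivity
  refine ⟨ℝ, inferInstance, Q, R, hR, fun s _ => ?_⟩
  have hae : ∀ᵐ u ∂Q, 0 < u :=
    (withDensity_absolutelyContinuous _ _).ae_le (ae_restrict_mem measurableSet_Ioi)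
  have hpre : (fun u => (R u)⁻¹) ⁻¹' Set.Ioc 0 s =ᵐ[Q] (Set.Ioc 0 s : Set ℝ) := by
    refine eventuallyEq_set.2 ?_
    filter_upwards [hae] with u hu
    simp [R, hu]
  rw [hR.ofReal_cdfInv, hR.measure_cdfInv, Measure.map_apply hR.measurable_inv measurableSet_Ioc,
    measure_congr hpre, withDensity_apply _ measurableSet_Ioc,
    Measure.restrict_restrict measurableSet_Ioc, Set.inter_eq_left.2 fun x hx => hx.1, cdfOfShape,
    lintegral_const_mul' _ _ (kappa_ne_top d)]

/-- A shape and a radius with the same tail correlation function are linked. -/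
theorem IsM2rShape.cdf_formula_of_common_tcf (hg : IsM2rShape d g) (h : IsRandomRadius Q R)
    (hd : 1 ≤ d) (hχ : ∃ χ, IsM2rTCF d g χ ∧ IsM3bTCF d Q R χ) :
    ∀ s > 0, ENNReal.ofReal (cdfInv Q R s) = cdfOfShape hg s := by
  -- The radius `R'` built from `g` has the same TCF as `R`, hence the same law, and the formula
  -- involves the radius only through the distribution function of its inverse.
  obtain ⟨F', _, Q', R', h', hs⟩ := hg.exists_radius hd
  obtain ⟨χ, hχ1, hχ2⟩ := hχ
  obtain ⟨χ', hχ1', hχ2'⟩ := hg.exists_common_tcf h' hd hs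
  have hχeq : χ = χ' :=
    ((isM2rTCF_iff hg.antitone).1 hχ1).2.trans ((isM2rTCF_iff hg.antitone).1 hχ1').2.symm
  subst hχeq
  have hfun := ((isM3TCF_iff.1 hχ2).2).symm.trans (isM3TCF_iff.1 hχ2').2
  have hmap : Q.map R = Q'.map R' := by
    refine h.map_eq_map h' hd fun t ht => ?_
    have ht' := congrFun hfun (EuclideanSpace.single (⟨0, hd⟩ : Fin d) t)
    simp only [h.shapeOverlap_ballShape hd, h'.shapeOverlap_ballShape hd,
      PiLp.norm_single, Real.norm_of_nonneg ht] at ht'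
    have hfin : ∀ {F : Type} [MeasurableSpace F] {Q : Measure F} {R : F → ℝ},
        IsRandomRadius Q R → ∫⁻ a, ENNReal.ofReal (hFun d (t / (2 * R a))) ∂Q ≠ ∞ := by
      intro F _ Q R h
      have := h.isProb
      have := isProbabilityMeasure_hLaw hd
      rw [← h.prod_hLaw_Ici hd ht]
      exact measure_ne_top _ _
    exact (ENNReal.toReal_eq_toReal_iff' (hfin h) (hfin h')).1 ht'
  have hinv : (Q.map fun a => (R a)⁻¹) = Q'.map fun a => (R' a)⁻¹ := by
    have h1 := congrArg (Measure.map fun x : ℝ => x⁻¹) hmap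
    rwa [Measure.map_map measurable_inv h.measurable, Measure.map_map measurable_inv h'.measurable]
      at h1
  have hcdf : cdfInv Q R = cdfInv Q' R' := by
    unfold cdfInv
    rw [hinv]
  rw [hcdf]
  exact hs

theorem tcfM2r_subset_tcfM3b (hd : 1 ≤ d) : tcfM2r d ⊆ tcfM3b d := by
  rintro χ ⟨g, hg, hχ⟩
  obtain ⟨hs, hχeq⟩ := (isM2rTCF_iff hg).1 hχ
  obtain ⟨F, mF, Q, R, h, hR⟩ := hs.exists_radius hd
  obtain ⟨χ', h1, h2⟩ := hs.exists_common_tcf h hd hR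
  have : χ = χ' := hχeq.trans ((isM2rTCF_iff hg).1 h1).2.symm
  exact ⟨F, mF, Q, R, h, this ▸ h2⟩

end Formulas

end

end TailCorr

theorem proposition3p1 (d : ℕ) (hd : 1 ≤ d) :
    -- a) the three sets of tail correlation functions coincide, and equal the class `H_d`
    (tcfM3r d = tcfM2r d ∧ tcfM2r d = tcfM3b d ∧ tcfM3b d = radial d '' gneitingClass d) ∧
    -- b) a shape `g` and a radius `R` have the same tail correlation function if and only if
    -- they are linked by either one of the two formulas (`g` is only determined up to its values
    -- at its discontinuities, the formula yields the left-continuous version)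
    (∀ (g : ℝ≥0 → ℝ≥0∞) (hg : IsM2rShape d g) (F : Type) (_ : MeasurableSpace F) (Q : Measure F)
      (R : F → ℝ), IsRandomRadius Q R →
      List.TFAE [
        ∃ χ, IsM2rTCF d g χ ∧ IsM3bTCF d Q R χ,
        ∀ u > 0, ContinuousWithinAt g (Set.Iic u) u → g u = shapeOfCdf d (cdfInv Q R) u,
        ∀ s > 0, ENNReal.ofReal (cdfInv Q R s) = cdfOfShape hg s]) ∧
    -- every shape arises in this way from a radius, given by the second formula
    (∀ (g : ℝ≥0 → ℝ≥0∞) (hg : IsM2rShape d g),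
      ∃ (F : Type) (_ : MeasurableSpace F) (Q : Measure F) (R : F → ℝ), IsRandomRadius Q R ∧
        ∀ s > 0, ENNReal.ofReal (cdfInv Q R s) = cdfOfShape hg s) ∧
    -- every radius arises in this way from a shape, given by the first formula
    (∀ (F : Type) (_ : MeasurableSpace F) (Q : Measure F) (R : F → ℝ), IsRandomRadius Q R →
      ∃ g : ℝ≥0 → ℝ≥0∞, IsM2rShape d g ∧ ∀ u > 0, g u = shapeOfCdf d (cdfInv Q R) u) := by
  have h32 := tcfM3r_subset_tcfM2r hd
  have h2b := tcfM2r_subset_tcfM3b hd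
  refine ⟨⟨h32.antisymm tcfM2r_subset_tcfM3r, h2b.antisymm (tcfM3b_subset_tcfM3r.trans h32),
    tcfM3b_eq hd⟩, fun g hg F _ Q R hR => ?_, fun g hg => hg.exists_radius hd,
    fun F _ Q R hR => ⟨meanShape hd Q fun a => ballShape d (R a),
      hR.isRandomShape.isM2rShape_meanShape hd fun a => ballShape_eq_radial d (hR.pos a).le,
      fun u hu => hR.meanShape_ballShape hd hu⟩⟩
  tfae_have 1 → 3 := hg.cdf_formula_of_common_tcf hR hd
  tfae_have 3 → 1 := hg.exists_common_tcf hR hd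
  tfae_have 2 ↔ 3 := (hg.shape_formula_iff hR hd).trans (hg.cdf_formula_iff hR).symm
  tfae_finish
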